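/- All Hilbert spaces are finite dimensional, with finitely many (and at least one) settings $x$ and finitely many outcomes $a$. A measurement assemblage on $\mathbb C^d$ ($d\ge 1$) is a family $\vec A=\{A_{a|x}\}$ with $A_{a|x}\ge 0$ and $\sum_a A_{a|x}=\mathbb 1$ for every $x$; it is jointly measurable if $A_{a|x}=\sum_\lambda p(a|x,\lambda)G_\lambda$ for some POVM $\{G_\lambda\}$ and conditional probabilities $p(a|x,\lambda)$. A state assemblage is a family $\vec\sigma=\{\sigma_{a|x}\}$ with $\sigma_{a|x}\ge 0$ and $\sum_a\sigma_{a|x}$ a density matrix independent of $x$; it is unsteerable (LHS) if $\sigma_{a|x}=\sum_\lambda p(\lambda)p(a|x,\lambda)\rho_\lambda$ with a probability distribution $p(\lambda)$, conditional probabilities $p(a|x,\lambda)$ and states $\rho_\lambda$. The robustness $\mathcal{IR}(\vec A)$ (respectively $\mathcal{SR}(\vec\sigma)$) is the minimal $t\ge 0$ such that $(A_{a|x}+tN_{a|x})/(1+t)$ is jointly measurable for some measurement assemblage $\vec N$ (respectively such that $(\sigma_{a|x}+t\xi_{a|x})/(1+t)$ is LHS for some state assemblage $\vec\xi$). For a bipartite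 state $\rho$ on $\mathbb C^d\otimes\mathbb C^{m}$ put $\sigma_{a|x}[\vec A,\rho]=\mathrm{tr}_A[(A_{a|x}\otimes\mathbb 1)\rho]$. Let $|\psi^+\rangle=d^{-1/2}\sum_i|ii\rangle$ and $\rho_\eta=d(\mathbb 1\otimes\eta^{1/2})|\psi^+\rangle\langle\psi^+|(\mathbb 1\otimes\eta^{1/2})$. Theorem. Let $\vec A$ be a measurement assemblage on $\mathbb C^d$. The minimum defining $\mathcal{IR}(\vec A)$ exists. (1) For every $\varepsilon>0$ there is a positive definite $\eta_\varepsilon$ with $\mathrm{tr}\,\eta_\varepsilon=1$ such that $\rho_{\eta_\varepsilon}$ is a state and $\mathcal{SR}(\vec\sigma[\vec A,\rho_{\eta_\varepsilon}])\ge\mathcal{IR}(\vec A)-\varepsilon$. (2) Such a state is computed by a semidefinite program. Consider the program: maximize $\mathrm{tr}\sum_{a,x}\omega_{a|x}A_{a|x}^T$ subject to $\omega_{a|x}\ge 0$, $\mathrm{tr}\,\eta=1$ and $\eta\ge\sum_{a,x}\delta_{a,s(x)}\,\omega_{a|x}$ for every function $s$ from settings to outcomes. Its maximum exists and equals $1+\mathcal{IR}(\vec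 A)$. Moreover, for every $\varepsilon>0$, every feasible $(\vec\omega,\eta)$ whose value is at least $1+\mathcal{IR}(\vec A)-\varepsilon/2$, and every $\delta\in(0,1]$ with $\delta\cdot\#\{\text{settings}\}\le\varepsilon/2$, the matrix $\eta_\varepsilon=(1-\delta)\eta+\frac{\delta}{d}\mathbb 1$ satisfies all the assertions of (1). (3) For every $m$ and every state $\rho$ on $\mathbb C^d\otimes\mathbb C^m$, the minimum defining $\mathcal{SR}(\vec\sigma[\vec A,\rho])$ exists and $\mathcal{SR}(\vec\sigma[\vec A,\rho])\le\mathcal{IR}(\vec A)$. This bound is saturated: $\mathcal{SR}(\vec\sigma[\vec A,\rho_\eta])=\mathcal{IR}(\vec A)$ for some $\eta\ge 0$ with $\mathrm{tr}\,\eta=1$, for which $\rho_\eta$ is a state. (4) The optimal state need not be maximally entangled: there is a measurement assemblage $\vec A$ on $\mathbb C^4$ with two settings and two outcomes such that $\mathcal{SR}(\vec\sigma[\vec A,\rho])<\mathcal{IR}(\vec A)$ for every maximally entangled state $\rho$ (pure, with both marginals maximally mixed) on $\mathbb C^4\otimes\mathbb C^4$. -/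

import Mathlib

open scoped Matrix Kronecker ComplexOrder MatrixOrder

noncomputable section

/-- A (density-matrix) state on `ℂ^ι`: positive semidefinite with unit trace. -/
def IsState {ι : Type*} [Fintype ι] (ρ : Matrix ι ι ℂ) : Prop :=
  ρ.PosSemidef ∧ ρ.trace = 1

/-- A measurement assemblage on `ℂ^n`: for each setting `x`, the effects `A x a` (that is,
`A_{a|x}`) form a POVM. -/
def IsMeasurementAssemblage {n X O : Type*} [DecidableEq n] [Fintype O]
    (A : X → O → Matrix n n ℂ) : Prop :=
  (∀ x a, (A x a).PosSemidef) ∧ ∀ x, ∑ a, A x a = 1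

/-- A state assemblage on `ℂ^m`: positive semidefinite operators `σ x a` (that is, `σ_{a|x}`)
whose sum over `a` is one and the same state for every setting `x`. -/
def IsStateAssemblage {m X O : Type*} [Fintype m] [Fintype O]
    (σ : X → O → Matrix m m ℂ) : Prop :=
  (∀ x a, (σ x a).PosSemidef) ∧ ∃ ρ : Matrix m m ℂ, IsState ρ ∧ ∀ x, ∑ a, σ x a = ρ

/-- Conditional probabilities `p l x a = p(a|x,l)`. -/
def IsResponse {L X O : Type*} [Fintype O] (p : L → X → O → ℝ) : Prop :=
  (∀ l x a, 0 ≤ p l x a) ∧ ∀ l x, ∑ a, p l x a = 1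

/-- `D` is a jointly measurable measurement assemblage: `D_{a|x} = ∑_l p(a|x,l) G_l` for a single
POVM `G`. -/
def IsJointlyMeasurable {n X O : Type*} [DecidableEq n] [Fintype O]
    (D : X → O → Matrix n n ℂ) : Prop :=
  ∃ (k : ℕ) (p : Fin k → X → O → ℝ) (G : Fin k → Matrix n n ℂ),
    IsResponse p ∧ (∀ l, (G l).PosSemidef) ∧ ∑ l, G l = 1 ∧
      ∀ x a, D x a = ∑ l, p l x a • G l

/-- `τ` admits a local-hidden-state model: `τ_{a|x} = ∑_l q(l) p(a|x,l) ρ_l`. -/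
def IsLHS {m X O : Type*} [Fintype m] [Fintype O] (τ : X → O → Matrix m m ℂ) : Prop :=
  ∃ (k : ℕ) (q : Fin k → ℝ) (p : Fin k → X → O → ℝ) (ρ : Fin k → Matrix m m ℂ),
    (∀ l, 0 ≤ q l) ∧ ∑ l, q l = 1 ∧ IsResponse p ∧ (∀ l, IsState (ρ l)) ∧
      ∀ x a, τ x a = ∑ l, (q l * p l x a) • ρ l

/-- The admissible noise parameters in the definition of the incompatibility robustness. -/
def incompatibilitySet {n X O : Type*} [DecidableEq n] [Fintype O]
    (A : X → O → Matrix n n ℂ) : Set ℝ :=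
  {t | 0 ≤ t ∧ ∃ N D : X → O → Matrix n n ℂ, IsMeasurementAssemblage N ∧
    IsJointlyMeasurable D ∧ ∀ x a, (1 + t)⁻¹ • (A x a + t • N x a) = D x a}

/-- The incompatibility robustness `IR(A)`. -/
def incompatibilityRobustness {n X O : Type*} [DecidableEq n] [Fintype O]
    (A : X → O → Matrix n n ℂ) : ℝ :=
  sInf (incompatibilitySet A)

/-- The admissible noise parameters in the definition of the steering robustness. -/
def steeringSet {m X O : Type*} [Fintype m] [Fintype O]
    (σ : X → O → Matrix m m ℂ) : Set ℝ :=
  {t | 0 ≤ t ∧ ∃ ξ τ : X → O → Matrix m m ℂ, IsStateAssemblage ξ ∧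
    IsLHS τ ∧ ∀ x a, (1 + t)⁻¹ • (σ x a + t • ξ x a) = τ x a}

/-- The steering robustness `SR(σ)`. -/
def steeringRobustness {m X O : Type*} [Fintype m] [Fintype O]
    (σ : X → O → Matrix m m ℂ) : ℝ :=
  sInf (steeringSet σ)

/-- Partial trace over the first tensor factor (Alice). -/
def partialTraceA {n m : Type*} [Fintype n] (M : Matrix (n × m) (n × m) ℂ) : Matrix m m ℂ :=
  fun i j => ∑ k, M (k, i) (k, j)

/-- Partial trace over the second tensor factor (Bob). -/
def partialTraceB {n m : Type*} [Fintype m] (M : Matrix (n × m) (n × m) ℂ) : Matrix n n ℂ :=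
  fun i j => ∑ k, M (i, k) (j, k)

/-- The assemblage `σ_{a|x} = tr_A[(A_{a|x} ⊗ 𝟙) ρ]` that Alice's measurements produce for Bob. -/
def steeredAssemblage {n m X O : Type*} [Fintype n] [Fintype m] [DecidableEq m]
    (A : X → O → Matrix n n ℂ) (ρ : Matrix (n × m) (n × m) ℂ) : X → O → Matrix m m ℂ :=
  fun x a => partialTraceA ((A x a ⊗ₖ (1 : Matrix m m ℂ)) * ρ)

/-- The vector `|ψ⁺⟩ = d^{-1/2} ∑_i |i i⟩`, with `d` the dimension of `ℂ^n`. -/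
def psiPlus (n : Type*) [Fintype n] [DecidableEq n] : n × n → ℂ :=
  fun ij => if ij.1 = ij.2 then (((Real.sqrt (Fintype.card n))⁻¹ : ℝ) : ℂ) else 0

/-- The operator `d (𝟙 ⊗ η^{1/2}) |ψ⁺⟩⟨ψ⁺| (𝟙 ⊗ η^{1/2})`. -/
def optimalState {n : Type*} [Fintype n] [DecidableEq n] (η : Matrix n n ℂ) :
    Matrix (n × n) (n × n) ℂ :=
  (Fintype.card n : ℂ) •
    (((1 : Matrix n n ℂ) ⊗ₖ CFC.sqrt η) *
      Matrix.vecMulVec (psiPlus n) (star (psiPlus n)) *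
      ((1 : Matrix n n ℂ) ⊗ₖ CFC.sqrt η))

/-- A maximally entangled state of `ℂ^n ⊗ ℂ^n`: a pure state both of whose marginals are
maximally mixed. -/
def IsMaximallyEntangled {n : Type*} [Fintype n] [DecidableEq n]
    (ρ : Matrix (n × n) (n × n) ℂ) : Prop :=
  (∃ v : n × n → ℂ, ρ = Matrix.vecMulVec v (star v)) ∧
    partialTraceA ρ = (Fintype.card n : ℂ)⁻¹ • (1 : Matrix n n ℂ) ∧
    partialTraceB ρ = (Fintype.card n : ℂ)⁻¹ • (1 : Matrix n n ℂ)

/-- The feasible region of the semidefinite program for the incompatibility robustness: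
`ω_{a|x} ≥ 0`, `tr η = 1` and, for every deterministic strategy `s : X → O`,
`η ≥ ∑_{a,x} D(a|x,s) ω_{a|x}`, where `D(a|x,s) = δ_{a,s(x)}`. -/
def SDPFeasible {n X O : Type*} [Fintype n] [Fintype X]
    (ω : X → O → Matrix n n ℂ) (η : Matrix n n ℂ) : Prop :=
  (∀ x a, (ω x a).PosSemidef) ∧ η.trace = 1 ∧
    ∀ s : X → O, (η - ∑ x, ω x (s x)).PosSemidef

/-- The objective `tr (∑_{a,x} ω_{a|x} B_{a|x})` of that program, for the assemblage `B`. -/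
def sdpValue {n X O : Type*} [Fintype n] [Fintype X] [Fintype O]
    (B ω : X → O → Matrix n n ℂ) : ℝ :=
  (∑ x, ∑ a, ω x a * B x a).trace.re

/-- The full-rank perturbation `(1 - δ) η + (δ / d) 𝟙` of `η`. -/
def fullRankPerturbation {n : Type*} [Fintype n] [DecidableEq n] (δ : ℝ)
    (η : Matrix n n ℂ) : Matrix n n ℂ :=
  (1 - δ) • η + (δ / (Fintype.card n : ℝ)) • (1 : Matrix n n ℂ)

end

/-!
Both robustnesses are semidefinite programs. Randomness in the response functions can be absorbed
into the hidden variable, so jointly measurable and unsteerable assemblages are exactly the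
coarse-grainings `∑_s δ_{a,s(x)} G_s` of operators `G_s ≥ 0` indexed by deterministic strategies `s`,
and the noise merely fills the gap between the given assemblage and a coarse-graining dominating
it (`mem_incompatibilitySet_iff`, `mem_steeringSet_iff`). The normalisation is `∑_s G_s = (1 + t) 𝟙`
in the first case and `tr ∑_s G_s = 1 + t` in the second.

The upper bound `SR ≤ IR` holds because `M ↦ tr_A[(M ⊗ 𝟙) ρ]` is a positive map that carries
admissible `G_s` to admissible ones (`incompatibilitySet_subset_steeringSet`).

The lower bound uses that `ρ_η` steers Bob to `η^{1/2} Aᵀ η^{1/2}`. If `(ω, η)` is feasible for the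
program and `S` is a pseudo-inverse of `η^{1/2}`, then the operators `S ω S` form a steering
inequality with `∑_x S ω_{s(x)|x} S ≤ 𝟙`, and its value on this assemblage is `tr ∑ ω Aᵀ`; no
invertibility of `η` is needed, since `0 ≤ ω ≤ η` confines `ω` to the range of `η`
(`sdpValue_le_of_mem_steeringSet`). Combined with the upper bound this is also weak duality for `IR`.

Strong duality comes from a separation argument: the pairs `(Y, Z)` with `Y` dominated by a
coarse-graining of operators whose sum is at most `Z` form a closed convex cone, and a functional
separating `(A, μ 𝟙)` from it is, after normalisation, a feasible point of value greater than `μ`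
(`exists_coarseGraining_of_sdpValue_le`). The program attains its maximum by compactness, hence
`IR` is attained and equals the maximum minus one, and an optimal `η` saturates `SR ≤ IR`.
Replacing `η` by `(1 - δ) η + (δ / d) 𝟙` keeps feasibility when `ω` is scaled by `1 - δ`, which costs
at most `δ` per setting (`fullRankPerturbation_spec`).

For the last assertion, take the direct sum on `ℂ² ⊕ ℂ²` of a trivial assemblage and the sharp
measurements of two Pauli operators. The second block makes `IR` positive, whereas for a maximally
entangled state only the trace of `∑_s G_s` counts, so that the first block, which needs no noise,
halves the amount required (`steeringRobustness_blockAssemblage_lt`).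
-/

/-! ### Positive semidefinite matrices -/

theorem re_trace_mul_nonneg {n : Type*} [Fintype n] {A B : Matrix n n ℂ}
    (hA : 0 ≤ A) (hB : 0 ≤ B) : 0 ≤ (A * B).trace.re := by
  classical
  obtain ⟨C, rfl⟩ := CStarAlgebra.nonneg_iff_eq_star_mul_self.mp hA
  rw [Matrix.mul_assoc, Matrix.trace_mul_comm]
  have h := ((Matrix.nonneg_iff_posSemidef.mp hB).mul_mul_conjTranspose_same C).trace_nonneg
  exact (Complex.le_def.mp h).1

theorem re_trace_mul_le_mul_left {n : Type*} [Fintype n] {A B C : Matrix n n ℂ}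
    (hA : 0 ≤ A) (h : B ≤ C) : (A * B).trace.re ≤ (A * C).trace.re := by
  have := re_trace_mul_nonneg hA (sub_nonneg.mpr h)
  rw [Matrix.mul_sub, Matrix.trace_sub, Complex.sub_re] at this
  linarith

theorem re_trace_mul_le_mul_right {n : Type*} [Fintype n] {A B C : Matrix n n ℂ}
    (hA : 0 ≤ A) (h : B ≤ C) : (B * A).trace.re ≤ (C * A).trace.re := by
  rw [Matrix.trace_mul_comm B, Matrix.trace_mul_comm C]
  exact re_trace_mul_le_mul_left hA h

theorem trace_eq_re {n : Type*} [Fintype n] {M : Matrix n n ℂ} (hM : 0 ≤ M) :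
    M.trace = (M.trace.re : ℂ) := by
  have h := Complex.le_def.mp (Matrix.nonneg_iff_posSemidef.mp hM).trace_nonneg
  exact Complex.ext rfl (by simpa using h.2.symm)

theorem re_trace_nonneg {n : Type*} [Fintype n] {M : Matrix n n ℂ} (hM : 0 ≤ M) :
    0 ≤ M.trace.re :=
  (Complex.le_def.mp (Matrix.nonneg_iff_posSemidef.mp hM).trace_nonneg).1

theorem eq_zero_of_re_trace {n : Type*} [Fintype n] {M : Matrix n n ℂ} (hM : 0 ≤ M)
    (h : M.trace.re ≤ 0) : M = 0 := by
  refine (Matrix.nonneg_iff_posSemidef.mp hM).trace_eq_zero_iff.mp ?_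
  rw [trace_eq_re hM, le_antisymm h (re_trace_nonneg hM), Complex.ofReal_zero]

theorem real_smul_nonneg {n : Type*} {c : ℝ} (hc : 0 ≤ c) {M : Matrix n n ℂ}
    (hM : 0 ≤ M) : 0 ≤ c • M :=
  ((Matrix.nonneg_iff_posSemidef.mp hM).smul hc).nonneg

theorem trace_real_smul {n : Type*} [Fintype n] (c : ℝ) (M : Matrix n n ℂ) :
    (c • M).trace = (c : ℂ) * M.trace := by
  rw [Matrix.trace_smul, Complex.real_smul]

/-- Every entry of a positive semidefinite matrix is bounded by its trace. -/
theorem norm_apply_le_re_trace {n : Type*} [Fintype n] {M : Matrix n n ℂ} (hM : 0 ≤ M)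
    (i j : n) : ‖M i j‖ ≤ M.trace.re := by
  classical
  obtain ⟨B, rfl⟩ := CStarAlgebra.nonneg_iff_eq_star_mul_self.mp hM
  have hd : ∀ i, ((star B * B) i i).re = ∑ k, ‖B k i‖ ^ 2 := by
    intro i
    simp only [Matrix.star_eq_conjTranspose, Matrix.mul_apply, Matrix.conjTranspose_apply,
      Complex.re_sum]
    refine Finset.sum_congr rfl fun k _ => ?_
    rw [Complex.star_def, ← Complex.normSq_eq_conj_mul_self, Complex.ofReal_re,
      Complex.normSq_eq_norm_sq]
  have hle : ∀ i, ∑ k, ‖B k i‖ ^ 2 ≤ (star B * B).trace.re := by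
    intro i
    rw [Matrix.trace, Complex.re_sum]
    simp only [Matrix.diag_apply, hd]
    exact Finset.single_le_sum (f := fun i => ∑ k, ‖B k i‖ ^ 2)
      (fun i _ => Finset.sum_nonneg fun k _ => sq_nonneg _) (Finset.mem_univ i)
  calc ‖(star B * B) i j‖ ≤ ∑ k, ‖B k i‖ * ‖B k j‖ := by
        simp only [Matrix.star_eq_conjTranspose, Matrix.mul_apply, Matrix.conjTranspose_apply]
        refine (norm_sum_le _ _).trans (Finset.sum_le_sum fun k _ => ?_)
        rw [norm_mul, norm_star]
    _ ≤ ∑ k, (‖B k i‖ ^ 2 + ‖B k j‖ ^ 2) / 2 :=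
        Finset.sum_le_sum fun k _ => by nlinarith [sq_nonneg (‖B k i‖ - ‖B k j‖)]
    _ ≤ (star B * B).trace.re := by
        rw [← Finset.sum_div, Finset.sum_add_distrib]
        linarith [hle i, hle j]

theorem isClosed_setOf_matrix_nonneg (n : Type*) [Fintype n] :
    IsClosed {M : Matrix n n ℂ | 0 ≤ M} := by
  have h : {M : Matrix n n ℂ | 0 ≤ M} =
      {M | Mᴴ = M} ∩ ⋂ v : n → ℂ, {M | 0 ≤ star v ⬝ᵥ (M *ᵥ v)} := by
    ext M
    simp only [Set.mem_ofPred_eq, Set.mem_inter_iff, Set.mem_iInter,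
      Matrix.nonneg_iff_posSemidef, Matrix.posSemidef_iff_dotProduct_mulVec]
    rfl
  rw [h]
  refine IsClosed.inter (isClosed_eq (by fun_prop) (by fun_prop)) (isClosed_iInter fun v => ?_)
  exact isClosed_le continuous_const (by fun_prop)

theorem isClosed_setOf_matrix_le {n : Type*} [Fintype n] {T : Type*} [TopologicalSpace T]
    {f g : T → Matrix n n ℂ} (hf : Continuous f) (hg : Continuous g) :
    IsClosed {t | f t ≤ g t} := by
  have := (isClosed_setOf_matrix_nonneg n).preimage (hg.sub hf)
  simpa only [Set.preimage_ofPred_eq, Pi.sub_apply, sub_nonneg] using this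

/-- Families of positive semidefinite matrices of bounded trace form a compact set. -/
theorem isCompact_setOf_nonneg_trace_le (n ι : Type*) [Fintype n] [Fintype ι] (c : ℝ) :
    IsCompact {G : ι → Matrix n n ℂ | ∀ s, 0 ≤ G s ∧ (G s).trace.re ≤ c} := by
  have hK : IsCompact {G : ι → Matrix n n ℂ | ∀ s i j, G s i j ∈ Metric.closedBall (0 : ℂ) c} := by
    have h := isCompact_univ_pi (fun _ : ι => isCompact_univ_pi (fun _ : n =>
      isCompact_univ_pi (fun _ : n => isCompact_closedBall (0 : ℂ) c)))
    have hs : {G : ι → Matrix n n ℂ | ∀ s i j, G s i j ∈ Metric.closedBall (0 : ℂ) c} =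
        Set.univ.pi fun _ => Set.univ.pi fun _ => Set.univ.pi fun _ =>
          Metric.closedBall (0 : ℂ) c := by
      exact Set.ext fun G =>
        ⟨fun h s _ i _ j _ => h s i j, fun h s i j => h s trivial i trivial j trivial⟩
    rw [hs]
    exact h
  refine hK.of_isClosed_subset ?_ ?_
  · simp only [Set.ofPred_forall]
    refine isClosed_iInter fun s => ?_
    refine IsClosed.inter (isClosed_setOf_matrix_le (by fun_prop) (by fun_prop)) ?_
    exact isClosed_le (Complex.continuous_re.comp
      (Continuous.matrix_trace (continuous_apply s))) continuous_const
  · intro G hG s i j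
    rw [mem_closedBall_zero_iff]
    exact (norm_apply_le_re_trace (hG s).1 i j).trans (hG s).2

/-! ### Deterministic response functions -/

/-- The assemblage `∑_s δ_{a,s(x)} G_s` obtained from operators `G_s` indexed by the
deterministic strategies `s : X → O`. -/
def coarseGraining {n X O : Type*} [Fintype X] [DecidableEq X] [Fintype O] [DecidableEq O]
    (G : (X → O) → Matrix n n ℂ) (x : X) (a : O) : Matrix n n ℂ :=
  ∑ s with s x = a, G s

section coarseGraining

variable {n X O : Type*} [Fintype X] [DecidableEq X] [Fintype O] [DecidableEq O]

theorem sum_coarseGraining (G : (X → O) → Matrix n n ℂ) (x : X) :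
    ∑ a, coarseGraining G x a = ∑ s, G s :=
  Finset.sum_fiberwise Finset.univ (fun s : X → O => s x) G

theorem coarseGraining_nonneg {G : (X → O) → Matrix n n ℂ} (hG : ∀ s, 0 ≤ G s) (x : X) (a : O) :
    0 ≤ coarseGraining G x a :=
  Finset.sum_nonneg fun s _ => hG s

theorem coarseGraining_smul (c : ℝ) (G : (X → O) → Matrix n n ℂ) (x : X) (a : O) :
    coarseGraining (fun s => c • G s) x a = c • coarseGraining G x a :=
  Finset.smul_sum.symm

theorem sum_trace_mul_coarseGraining [Fintype n] (ω : X → O → Matrix n n ℂ)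
    (G : (X → O) → Matrix n n ℂ) :
    (∑ x, ∑ a, ω x a * coarseGraining G x a).trace
      = ∑ s : X → O, ((∑ x, ω x (s x)) * G s).trace := by
  rw [← Matrix.trace_sum]
  refine congrArg Matrix.trace ?_
  simp only [Finset.sum_mul]
  refine Eq.trans ?_ Finset.sum_comm
  refine Finset.sum_congr rfl fun x _ => ?_
  rw [← Finset.sum_fiberwise Finset.univ (fun s : X → O => s x) fun s => ω x (s x) * G s]
  refine Finset.sum_congr rfl fun a _ => ?_
  rw [coarseGraining, Finset.mul_sum]
  refine Finset.sum_congr rfl fun s hs => ?_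
  rw [(Finset.mem_filter.mp hs).2]

/-- Independent choices of the outcomes have the prescribed marginals. -/
theorem sum_prod_response {p : X → O → ℝ} (hp : ∀ x, ∑ a, p x a = 1) (x : X) (a : O) :
    ∑ s : X → O with s x = a, ∏ y, p y (s y) = p x a := by
  have h : (Finset.univ.filter fun s : X → O => s x = a)
      = Fintype.piFinset fun y => if y = x then {a} else Finset.univ := by
    ext s
    simp only [Finset.mem_filter, Finset.mem_univ, true_and, Fintype.mem_piFinset]
    refine ⟨fun h y => ?_, fun h => by simpa using h x⟩
    split_ifs with hy
    · subst hy; simpa using h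
    · exact Finset.mem_univ _
  rw [h, ← Finset.prod_univ_sum, Finset.prod_eq_single x]
  · simp
  · intro y _ hy
    rw [if_neg hy, hp]
  · simp

/-- Randomness of a response function can be absorbed into the hidden variable. -/
theorem exists_coarseGraining_eq [Fintype n] {L : Type*} [Fintype L] {p : L → X → O → ℝ}
    (hp : IsResponse p) {H : L → Matrix n n ℂ} (hH : ∀ l, 0 ≤ H l) :
    ∃ G : (X → O) → Matrix n n ℂ, (∀ s, 0 ≤ G s) ∧ ∑ s, G s = ∑ l, H l ∧
      ∀ x a, ∑ l, p l x a • H l = coarseGraining G x a := by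
  refine ⟨fun s => ∑ l, (∏ x, p l x (s x)) • H l, fun s => Finset.sum_nonneg fun l _ =>
    real_smul_nonneg (Finset.prod_nonneg fun x _ => hp.1 l x _) (hH l), ?_, fun x a => ?_⟩
  · rw [Finset.sum_comm]
    refine Finset.sum_congr rfl fun l _ => ?_
    have h : ∑ s : X → O, ∏ x, p l x (s x) = 1 := by
      rw [← Fintype.piFinset_univ, ← Finset.prod_univ_sum]
      exact Finset.prod_eq_one fun x _ => hp.2 l x
    rw [← Finset.sum_smul, h, one_smul]
  · rw [coarseGraining, Finset.sum_comm]
    refine Finset.sum_congr rfl fun l _ => ?_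
    rw [← Finset.sum_smul, sum_prod_response (hp.2 l)]

omit [Fintype X] [DecidableEq X] in
theorem isResponse_deterministic {L : Type*} (e : L → X → O) :
    IsResponse fun l x a => if e l x = a then (1 : ℝ) else 0 := by
  refine ⟨fun l x a => ?_, fun l x => by simp⟩
  dsimp only
  split_ifs <;> norm_num

theorem sum_deterministic_smul {k : ℕ} (e : Fin k ≃ (X → O)) (G : (X → O) → Matrix n n ℂ)
    (x : X) (a : O) :
    ∑ l, (if e l x = a then (1 : ℝ) else 0) • G (e l) = coarseGraining G x a := by
  rw [Equiv.sum_comp e (fun s => (if s x = a then (1 : ℝ) else 0) • G s), coarseGraining,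
    Finset.sum_filter]
  refine Finset.sum_congr rfl fun s _ => ?_
  split_ifs <;> simp

theorem isJointlyMeasurable_iff [Fintype n] [DecidableEq n] {D : X → O → Matrix n n ℂ} :
    IsJointlyMeasurable D ↔ ∃ G : (X → O) → Matrix n n ℂ, (∀ s, 0 ≤ G s) ∧ ∑ s, G s = 1 ∧
      ∀ x a, D x a = coarseGraining G x a := by
  constructor
  · rintro ⟨k, p, H, hp, hH, hsum, hD⟩
    obtain ⟨G, hG, hGs, hGc⟩ := exists_coarseGraining_eq hp fun l => (hH l).nonneg
    exact ⟨G, hG, hGs.trans hsum, fun x a => (hD x a).trans (hGc x a)⟩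
  · rintro ⟨G, hG, hsum, hD⟩
    have e := (Fintype.equivFin (X → O)).symm
    exact ⟨_, _, fun l => G (e l), isResponse_deterministic e, fun l => Matrix.nonneg_iff_posSemidef.mp (hG _),
      (Equiv.sum_comp e G).trans hsum,
      fun x a => (hD x a).trans (sum_deterministic_smul e G x a).symm⟩

theorem isLHS_iff [Fintype n] {τ : X → O → Matrix n n ℂ} :
    IsLHS τ ↔ ∃ G : (X → O) → Matrix n n ℂ, (∀ s, 0 ≤ G s) ∧ (∑ s, G s).trace = 1 ∧
      ∀ x a, τ x a = coarseGraining G x a := by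
  constructor
  · rintro ⟨k, q, p, ρ, hq, hq1, hp, hρ, hτ⟩
    obtain ⟨G, hG, hGs, hGc⟩ := exists_coarseGraining_eq (H := fun l => q l • ρ l) hp
      fun l => real_smul_nonneg (hq l) (hρ l).1.nonneg
    refine ⟨G, hG, ?_, fun x a => ?_⟩
    · rw [hGs, Matrix.trace_sum]
      simp only [trace_real_smul, (hρ _).2, mul_one]
      exact_mod_cast hq1
    · rw [hτ, ← hGc]
      simp only [smul_smul, mul_comm]
  · rintro ⟨G, hG, hsum, hτ⟩
    classical
    have e := (Fintype.equivFin (X → O)).symm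
    have hn : Nonempty n := by
      by_contra h
      rw [not_nonempty_iff] at h
      simp [Matrix.trace] at hsum
    obtain ⟨i⟩ := hn
    -- a vanishing `G_s` has no normalisation: any state will do for it
    let ρ : (X → O) → Matrix n n ℂ := fun s =>
      if (G s).trace.re = 0 then Matrix.single i i 1 else ((G s).trace.re)⁻¹ • G s
    have hρ : ∀ s, IsState (ρ s) := by
      intro s
      by_cases h : (G s).trace.re = 0
      · simp only [ρ, if_pos h]
        refine ⟨?_, by simp⟩
        have := Matrix.posSemidef_vecMulVec_self_star (Pi.single i (1 : ℂ))
        convert this using 1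
        ext a b
        simp [Matrix.single_apply, Matrix.vecMulVec_apply, Pi.single_apply]
        grind
      · simp only [ρ, if_neg h]
        refine ⟨Matrix.nonneg_iff_posSemidef.mp
          (real_smul_nonneg (inv_nonneg.mpr (re_trace_nonneg (hG s))) (hG s)), ?_⟩
        rw [trace_real_smul, trace_eq_re (hG s), Complex.ofReal_re]
        exact_mod_cast inv_mul_cancel₀ h
    have hqρ : ∀ s, (G s).trace.re • ρ s = G s := by
      intro s
      by_cases h : (G s).trace.re = 0
      · rw [h, zero_smul, eq_zero_of_re_trace (hG s) h.le]
      · simp only [ρ, if_neg h, smul_smul, mul_inv_cancel₀ h, one_smul]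
    refine ⟨_, fun l => (G (e l)).trace.re, _, fun l => ρ (e l),
      fun l => re_trace_nonneg (hG _), ?_, isResponse_deterministic e, fun l => hρ _, ?_⟩
    · rw [Equiv.sum_comp e (fun s => (G s).trace.re), ← Complex.re_sum, ← Matrix.trace_sum, hsum,
        Complex.one_re]
    · intro x a
      rw [hτ, ← sum_deterministic_smul e]
      refine Finset.sum_congr rfl fun l _ => ?_
      rw [mul_comm, mul_smul, hqρ]

end coarseGraining

/-! ### The robustnesses in terms of deterministic strategies -/

section robustness

variable {n X O : Type*} [Fintype n] [Fintype X] [DecidableEq X] [Fintype O] [DecidableEq O]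

/-- The incompatibility robustness is a semidefinite program: the noise only has to fill the gap
between `A` and an unnormalised jointly measurable assemblage dominating it. -/
theorem mem_incompatibilitySet_iff [DecidableEq n] [Nonempty n] [Nonempty X]
    {A : X → O → Matrix n n ℂ} (hA : IsMeasurementAssemblage A) {t : ℝ} :
    t ∈ incompatibilitySet A ↔ ∃ G : (X → O) → Matrix n n ℂ, (∀ s, 0 ≤ G s) ∧
      ∑ s, G s = (1 + t) • (1 : Matrix n n ℂ) ∧ ∀ x a, A x a ≤ coarseGraining G x a := by
  constructor
  · rintro ⟨ht, N, D, hN, hD, h⟩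
    obtain ⟨G, hG, hG1, hGD⟩ := isJointlyMeasurable_iff.mp hD
    have ht' : (0 : ℝ) < 1 + t := by linarith
    refine ⟨fun s => (1 + t) • G s, fun s => real_smul_nonneg ht'.le (hG s), ?_, fun x a => ?_⟩
    · rw [← Finset.smul_sum, hG1]
    · rw [coarseGraining_smul, ← hGD, ← h, smul_inv_smul₀ ht'.ne']
      exact le_add_of_nonneg_right (real_smul_nonneg ht (hN.1 x a).nonneg)
  · rintro ⟨G, hG, hG1, hGA⟩
    obtain ⟨x₀⟩ := ‹Nonempty X›
    obtain ⟨i⟩ := ‹Nonempty n›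
    have ht : 0 ≤ t := by
      have h : (1 : Matrix n n ℂ) ≤ (1 + t) • (1 : Matrix n n ℂ) := by
        rw [← hG1, ← sum_coarseGraining G x₀, ← hA.2 x₀]
        exact Finset.sum_le_sum fun a _ => hGA x₀ a
      have h' := (Complex.le_def.mp ((Matrix.le_iff.mp h).diag_nonneg (i := i))).1
      simp only [Matrix.sub_apply, Matrix.smul_apply, Matrix.one_apply_eq, Complex.sub_re,
        Complex.real_smul, mul_one, Complex.zero_re, Complex.ofReal_re, Complex.one_re] at h'
      linarith
    have ht' : (0 : ℝ) < 1 + t := by linarith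
    have hD : IsJointlyMeasurable fun x a => (1 + t)⁻¹ • coarseGraining G x a :=
      isJointlyMeasurable_iff.mpr ⟨fun s => (1 + t)⁻¹ • G s,
        fun s => real_smul_nonneg (inv_nonneg.mpr ht'.le) (hG s),
        by rw [← Finset.smul_sum, hG1, inv_smul_smul₀ ht'.ne'],
        fun x a => (coarseGraining_smul _ _ _ _).symm⟩
    rcases ht.eq_or_lt with rfl | ht0
    · -- without noise the domination is an equality, since both sides sum to `1`
      have heq : ∀ x a, coarseGraining G x a = A x a := by
        intro x a
        have h0 : ∑ a, (coarseGraining G x a - A x a) = 0 := by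
          rw [Finset.sum_sub_distrib, sum_coarseGraining, hG1, hA.2]
          simp
        exact sub_eq_zero.mp ((Finset.sum_eq_zero_iff_of_nonneg
          fun a _ => sub_nonneg.mpr (hGA x a)).mp h0 a (Finset.mem_univ a))
      exact ⟨le_rfl, A, _, hA, hD, fun x a => by simp [heq]⟩
    · refine ⟨ht, fun x a => t⁻¹ • (coarseGraining G x a - A x a), _, ⟨fun x a => ?_, fun x => ?_⟩,
        hD, fun x a => ?_⟩
      · exact Matrix.nonneg_iff_posSemidef.mp
          (real_smul_nonneg (inv_nonneg.mpr ht) (sub_nonneg.mpr (hGA x a)))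
      · rw [← Finset.smul_sum, Finset.sum_sub_distrib, sum_coarseGraining, hG1, hA.2, add_smul,
          one_smul, add_sub_cancel_left, inv_smul_smul₀ ht0.ne']
      · rw [smul_inv_smul₀ ht0.ne', add_sub_cancel]

/-- The steering robustness is a semidefinite program: the noise only has to fill the gap
between `σ` and an unnormalised unsteerable assemblage dominating it. -/
theorem mem_steeringSet_iff [Nonempty X] {σ : X → O → Matrix n n ℂ}
    (hσ : IsStateAssemblage σ) {t : ℝ} :
    t ∈ steeringSet σ ↔ ∃ G : (X → O) → Matrix n n ℂ, (∀ s, 0 ≤ G s) ∧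
      (∑ s, G s).trace.re = 1 + t ∧ ∀ x a, σ x a ≤ coarseGraining G x a := by
  obtain ⟨hσ0, ρ, hρ, hσρ⟩ := id hσ
  constructor
  · rintro ⟨ht, ξ, τ, hξ, hτ, h⟩
    obtain ⟨G, hG, hG1, hGτ⟩ := isLHS_iff.mp hτ
    have ht' : (0 : ℝ) < 1 + t := by linarith
    refine ⟨fun s => (1 + t) • G s, fun s => real_smul_nonneg ht'.le (hG s), ?_, fun x a => ?_⟩
    · rw [← Finset.smul_sum, trace_real_smul, hG1, mul_one, Complex.ofReal_re]
    · rw [coarseGraining_smul, ← hGτ, ← h, smul_inv_smul₀ ht'.ne']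
      exact le_add_of_nonneg_right (real_smul_nonneg ht (hξ.1 x a).nonneg)
  · rintro ⟨G, hG, hG1, hGσ⟩
    obtain ⟨x₀⟩ := ‹Nonempty X›
    have hgap : ∀ x, ∑ a, (coarseGraining G x a - σ x a) = ∑ s, G s - ρ := fun x => by
      rw [Finset.sum_sub_distrib, sum_coarseGraining, hσρ]
    have hgap0 : ∀ x a, 0 ≤ coarseGraining G x a - σ x a := fun x a => sub_nonneg.mpr (hGσ x a)
    have hGtr : (∑ s, G s).trace = ((1 + t : ℝ) : ℂ) := by
      rw [trace_eq_re (Finset.sum_nonneg fun s _ => hG s), hG1]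
    have htr : (∑ s, G s - ρ).trace = (t : ℂ) := by
      rw [Matrix.trace_sub, hGtr, hρ.2]
      push_cast
      ring
    have ht : 0 ≤ t := by
      have := re_trace_nonneg (Finset.sum_nonneg fun a (_ : a ∈ Finset.univ) => hgap0 x₀ a)
      rwa [hgap, htr, Complex.ofReal_re] at this
    have ht' : (0 : ℝ) < 1 + t := by linarith
    have hτ : IsLHS fun x a => (1 + t)⁻¹ • coarseGraining G x a :=
      isLHS_iff.mpr ⟨fun s => (1 + t)⁻¹ • G s,
        fun s => real_smul_nonneg (inv_nonneg.mpr ht'.le) (hG s),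
        by
          rw [← Finset.smul_sum, trace_real_smul, hGtr]
          exact_mod_cast inv_mul_cancel₀ ht'.ne',
        fun x a => (coarseGraining_smul _ _ _ _).symm⟩
    rcases ht.eq_or_lt with rfl | ht0
    · -- without noise the domination is an equality, since both sides have total trace `1`
      have heq : ∀ x a, coarseGraining G x a = σ x a := by
        intro x a
        have h0 : ∑ a, (coarseGraining G x a - σ x a) = 0 :=
          eq_zero_of_re_trace (Finset.sum_nonneg fun a _ => hgap0 x a)
            (by rw [hgap, htr, Complex.ofReal_re])
        exact sub_eq_zero.mp ((Finset.sum_eq_zero_iff_of_nonneg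
          fun a _ => hgap0 x a).mp h0 a (Finset.mem_univ a))
      exact ⟨le_rfl, σ, _, hσ, hτ, fun x a => by simp [heq]⟩
    · refine ⟨ht, fun x a => t⁻¹ • (coarseGraining G x a - σ x a), _,
        ⟨fun x a => ?_, t⁻¹ • (∑ s, G s - ρ), ⟨?_, ?_⟩, fun x => ?_⟩, hτ, fun x a => ?_⟩
      · exact Matrix.nonneg_iff_posSemidef.mp
          (real_smul_nonneg (inv_nonneg.mpr ht) (hgap0 x a))
      · rw [← hgap x₀]
        exact Matrix.nonneg_iff_posSemidef.mp
          (real_smul_nonneg (inv_nonneg.mpr ht) (Finset.sum_nonneg fun a _ => hgap0 x₀ a))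
      · rw [trace_real_smul, htr]
        exact_mod_cast inv_mul_cancel₀ ht0.ne'
      · rw [← Finset.smul_sum, hgap]
      · rw [smul_inv_smul₀ ht0.ne', add_sub_cancel]

omit [Fintype n] in
theorem continuous_coarseGraining (x : X) (a : O) :
    Continuous fun G : (X → O) → Matrix n n ℂ => coarseGraining G x a :=
  continuous_finsetSum _ fun s _ => continuous_apply s

theorem continuous_re_trace {T : Type*} [TopologicalSpace T] {f : T → Matrix n n ℂ}
    (hf : Continuous f) : Continuous fun t => (f t).trace.re :=
  Complex.continuous_re.comp hf.matrix_trace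

theorem re_trace_le_re_trace_sum {ι : Type*} [Fintype ι] {G : ι → Matrix n n ℂ}
    (hG : ∀ s, 0 ≤ G s) (s : ι) : (G s).trace.re ≤ (∑ s, G s).trace.re := by
  rw [Matrix.trace_sum, Complex.re_sum]
  exact Finset.single_le_sum (f := fun s => (G s).trace.re)
    (fun s _ => re_trace_nonneg (hG s)) (Finset.mem_univ s)

/-- The minimum defining the steering robustness is attained. -/
theorem isLeast_steeringSet [Nonempty X] {σ : X → O → Matrix n n ℂ} (hσ : IsStateAssemblage σ)
    (hne : (steeringSet σ).Nonempty) : IsLeast (steeringSet σ) (steeringRobustness σ) := by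
  obtain ⟨T, hT⟩ := hne
  obtain ⟨G₁, hG₁, hG₁T, hG₁σ⟩ := (mem_steeringSet_iff hσ).mp hT
  let K : Set ((X → O) → Matrix n n ℂ) :=
    {G | ∀ s, 0 ≤ G s ∧ (G s).trace.re ≤ 1 + T} ∩ {G | ∀ x a, σ x a ≤ coarseGraining G x a}
  have hK : IsCompact K := by
    refine (isCompact_setOf_nonneg_trace_le n (X → O) (1 + T)).inter_right ?_
    simp only [Set.ofPred_forall]
    exact isClosed_iInter fun x => isClosed_iInter fun a =>
      isClosed_setOf_matrix_le continuous_const (continuous_coarseGraining x a)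
  have hmem : ∀ G : (X → O) → Matrix n n ℂ, (∀ s, 0 ≤ G s) → (∑ s, G s).trace.re ≤ 1 + T →
      (∀ x a, σ x a ≤ coarseGraining G x a) → G ∈ K := fun G hG hGT hGσ =>
    ⟨fun s => ⟨hG s, (re_trace_le_re_trace_sum hG s).trans hGT⟩, hGσ⟩
  obtain ⟨G₀, hG₀, hmin⟩ := hK.exists_isMinOn ⟨G₁, hmem G₁ hG₁ hG₁T.le hG₁σ⟩
    (f := fun G => (∑ s, G s).trace.re) (continuous_re_trace (by fun_prop)).continuousOn
  have hleast : IsLeast (steeringSet σ) ((∑ s, G₀ s).trace.re - 1) := by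
    refine ⟨(mem_steeringSet_iff hσ).mpr ⟨G₀, fun s => (hG₀.1 s).1, by ring, hG₀.2⟩, ?_⟩
    intro t ht
    obtain ⟨G, hG, hGt, hGσ⟩ := (mem_steeringSet_iff hσ).mp ht
    have h₁ : (∑ s, G₀ s).trace.re ≤ (∑ s, G₁ s).trace.re :=
      hmin (hmem G₁ hG₁ hG₁T.le hG₁σ)
    rcases le_total t T with h | h
    · have : (∑ s, G₀ s).trace.re ≤ (∑ s, G s).trace.re := hmin (hmem G hG (by linarith) hGσ)
      linarith
    · linarith
  rw [steeringRobustness, hleast.csInf_eq]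
  exact hleast

end robustness

/-! ### The steering map -/

section steeringMap

variable {n m : Type*} [Fintype n] [Fintype m] [DecidableEq m]

/-- The linear map `M ↦ tr_A[(M ⊗ 𝟙) ρ]` that turns Alice's effects into Bob's conditional
(unnormalised) states. -/
noncomputable def steeringMap (ρ : Matrix (n × m) (n × m) ℂ) : Matrix n n ℂ →ₗ[ℂ] Matrix m m ℂ where
  toFun M := partialTraceA ((M ⊗ₖ (1 : Matrix m m ℂ)) * ρ)
  map_add' M N := by
    ext i j
    simp only [partialTraceA, Matrix.add_kronecker, Matrix.add_mul, Matrix.add_apply,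
      Finset.sum_add_distrib]
  map_smul' c M := by
    ext i j
    simp only [partialTraceA, Matrix.smul_kronecker, Matrix.smul_mul, Matrix.smul_apply,
      Finset.smul_sum, RingHom.id_apply]

theorem steeredAssemblage_apply {X O : Type*} (A : X → O → Matrix n n ℂ)
    (ρ : Matrix (n × m) (n × m) ℂ) (x : X) (a : O) :
    steeredAssemblage A ρ x a = steeringMap ρ (A x a) := rfl

theorem kronecker_one_mul_apply (M : Matrix n n ℂ) (ρ : Matrix (n × m) (n × m) ℂ)
    (i : n) (j : m) (q : n × m) :
    ((M ⊗ₖ (1 : Matrix m m ℂ)) * ρ) (i, j) q = ∑ k, M i k * ρ (k, j) q := by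
  rw [Matrix.mul_apply, Fintype.sum_prod_type]
  refine Finset.sum_congr rfl fun k _ => ?_
  simp [Matrix.one_apply]

theorem steeringMap_apply (ρ : Matrix (n × m) (n × m) ℂ) (M : Matrix n n ℂ) (j l : m) :
    steeringMap ρ M j l = ∑ i, ∑ k, M i k * ρ (k, j) (i, l) :=
  Finset.sum_congr rfl fun i _ => kronecker_one_mul_apply M ρ i j (i, l)

theorem trace_steeringMap (ρ : Matrix (n × m) (n × m) ℂ) (M : Matrix n n ℂ) :
    (steeringMap ρ M).trace = (M * partialTraceB ρ).trace := by
  simp only [Matrix.trace, Matrix.diag_apply, steeringMap_apply, Matrix.mul_apply, partialTraceB,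
    Finset.mul_sum]
  rw [Finset.sum_comm]
  exact Finset.sum_congr rfl fun i _ => Finset.sum_comm

omit [DecidableEq m] in
theorem trace_partialTraceB (ρ : Matrix (n × m) (n × m) ℂ) :
    (partialTraceB ρ).trace = ρ.trace := by
  simp only [Matrix.trace, Matrix.diag_apply, partialTraceB, Fintype.sum_prod_type]

/-- The steering map of a positive semidefinite operator is positive: for `M = CᴴC`,
cyclicity on Alice's side gives `tr_A[(M ⊗ 𝟙) ρ] = tr_A[(C ⊗ 𝟙) ρ (C ⊗ 𝟙)ᴴ]`. -/
theorem steeringMap_nonneg {ρ : Matrix (n × m) (n × m) ℂ} (hρ : 0 ≤ ρ) {M : Matrix n n ℂ}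
    (hM : 0 ≤ M) : 0 ≤ steeringMap ρ M := by
  classical
  obtain ⟨C, rfl⟩ := CStarAlgebra.nonneg_iff_eq_star_mul_self.mp hM
  have h : steeringMap ρ (star C * C) = ∑ r : n,
      (((C ⊗ₖ (1 : Matrix m m ℂ)) * ρ * (C ⊗ₖ (1 : Matrix m m ℂ))ᴴ).submatrix
        (fun j => (r, j)) fun j => (r, j)) := by
    ext j l
    have hr : ∀ r, ((C ⊗ₖ (1 : Matrix m m ℂ)) * ρ * (C ⊗ₖ (1 : Matrix m m ℂ))ᴴ) (r, j) (r, l)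
        = ∑ i, ∑ k, star (C r i) * C r k * ρ (k, j) (i, l) := by
      intro r
      rw [Matrix.mul_apply, Fintype.sum_prod_type]
      refine Finset.sum_congr rfl fun i _ => ?_
      simp only [kronecker_one_mul_apply, Matrix.conjTranspose_apply, Matrix.kroneckerMap_apply,
        Matrix.one_apply]
      rw [Finset.sum_eq_single l (fun b _ hb => by simp [hb.symm]) (by simp), Finset.sum_mul]
      refine Finset.sum_congr rfl fun k _ => ?_
      simp only [if_true, mul_one]
      ring
    rw [steeringMap_apply, Matrix.sum_apply]
    simp only [Matrix.submatrix_apply, hr, Matrix.mul_apply, Matrix.star_apply, Finset.sum_mul]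
    exact (Finset.sum_congr rfl fun i _ => Finset.sum_comm).trans Finset.sum_comm
  rw [h]
  exact Finset.sum_nonneg fun r _ => (((Matrix.nonneg_iff_posSemidef.mp hρ).mul_mul_conjTranspose_same
    _).submatrix _).nonneg

theorem steeringMap_mono {ρ : Matrix (n × m) (n × m) ℂ} (hρ : 0 ≤ ρ) {M N : Matrix n n ℂ}
    (h : M ≤ N) : steeringMap ρ M ≤ steeringMap ρ N := by
  have := steeringMap_nonneg hρ (sub_nonneg.mpr h)
  rwa [map_sub, sub_nonneg] at this

variable {X O : Type*} [Fintype X] [DecidableEq X] [Fintype O] [DecidableEq O]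

theorem steeringMap_coarseGraining (ρ : Matrix (n × m) (n × m) ℂ) (G : (X → O) → Matrix n n ℂ)
    (x : X) (a : O) :
    steeringMap ρ (coarseGraining G x a) = coarseGraining (fun s => steeringMap ρ (G s)) x a :=
  map_sum _ _ _

omit [Fintype X] [DecidableEq X] [DecidableEq O] in
theorem isStateAssemblage_steeredAssemblage [DecidableEq n] {A : X → O → Matrix n n ℂ}
    (hA : IsMeasurementAssemblage A) {ρ : Matrix (n × m) (n × m) ℂ} (hρ : IsState ρ) :
    IsStateAssemblage (steeredAssemblage A ρ) := by
  refine ⟨fun x a => Matrix.nonneg_iff_posSemidef.mp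
    (steeringMap_nonneg hρ.1.nonneg (hA.1 x a).nonneg), steeringMap ρ 1, ⟨?_, ?_⟩, fun x => ?_⟩
  · exact Matrix.nonneg_iff_posSemidef.mp
      (steeringMap_nonneg hρ.1.nonneg Matrix.PosSemidef.one.nonneg)
  · rw [trace_steeringMap, one_mul, trace_partialTraceB, hρ.2]
  · simp only [steeredAssemblage_apply]
    rw [← map_sum, hA.2]

/-- Steering cannot be more robust than the incompatibility it originates from. -/
theorem incompatibilitySet_subset_steeringSet [DecidableEq n] [Nonempty n] [Nonempty X]
    {A : X → O → Matrix n n ℂ} (hA : IsMeasurementAssemblage A)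
    {ρ : Matrix (n × m) (n × m) ℂ} (hρ : IsState ρ) :
    incompatibilitySet A ⊆ steeringSet (steeredAssemblage A ρ) := by
  intro t ht
  obtain ⟨G, hG, hG1, hGA⟩ := (mem_incompatibilitySet_iff hA).mp ht
  refine (mem_steeringSet_iff (isStateAssemblage_steeredAssemblage hA hρ)).mpr
    ⟨fun s => steeringMap ρ (G s), fun s => steeringMap_nonneg hρ.1.nonneg (hG s), ?_,
      fun x a => ?_⟩
  · rw [← map_sum, hG1, trace_steeringMap, Matrix.smul_mul, one_mul, trace_real_smul,
      trace_partialTraceB, hρ.2, mul_one, Complex.ofReal_re]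
  · rw [← steeringMap_coarseGraining]
    exact steeringMap_mono hρ.1.nonneg (hGA x a)

end steeringMap

/-! ### The states `ρ_η` -/

section optimalState

variable {n : Type*} [Fintype n] [DecidableEq n]

/-- `ρ_η` is the rank-one operator given by the vectorisation of `(η^{1/2})ᵀ`. -/
theorem optimalState_eq [Nonempty n] (η : Matrix n n ℂ) :
    optimalState η = Matrix.vecMulVec (fun p : n × n => CFC.sqrt η p.2 p.1)
      (star fun p : n × n => CFC.sqrt η p.2 p.1) := by
  have hR : (CFC.sqrt η)ᴴ = CFC.sqrt η := (CFC.sqrt_nonneg η).isSelfAdjoint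
  set R := CFC.sqrt η with hRdef
  have hd : (Fintype.card n : ℂ) ≠ 0 := Nat.cast_ne_zero.mpr Fintype.card_ne_zero
  have hψ : ∀ p : n × n, (((1 : Matrix n n ℂ) ⊗ₖ R) *ᵥ psiPlus n) p
      = (((Real.sqrt (Fintype.card n))⁻¹ : ℝ) : ℂ) * R p.2 p.1 := by
    rintro ⟨i, j⟩
    simp only [Matrix.mulVec, dotProduct, Fintype.sum_prod_type, psiPlus,
      Matrix.kroneckerMap_apply, Matrix.one_apply]
    rw [Finset.sum_eq_single i (fun b _ hb => by simp [hb.symm]) (by simp),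
      Finset.sum_eq_single i (fun b _ hb => by simp [hb.symm]) (by simp)]
    simp [mul_comm]
  have hs : (((Real.sqrt (Fintype.card n))⁻¹ : ℝ) : ℂ) * (((Real.sqrt (Fintype.card n))⁻¹ : ℝ) : ℂ)
      = (Fintype.card n : ℂ)⁻¹ := by
    rw [← Complex.ofReal_mul, ← mul_inv, Real.mul_self_sqrt (Nat.cast_nonneg _)]
    simp
  have hK : ((1 : Matrix n n ℂ) ⊗ₖ R)ᴴ = (1 : Matrix n n ℂ) ⊗ₖ R := by
    rw [Matrix.conjTranspose_kronecker, Matrix.conjTranspose_one, hR]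
  have hv : Matrix.vecMulVec (psiPlus n) (star (psiPlus n)) * ((1 : Matrix n n ℂ) ⊗ₖ R)
      = Matrix.vecMulVec (psiPlus n) (star (((1 : Matrix n n ℂ) ⊗ₖ R) *ᵥ psiPlus n)) := by
    rw [Matrix.vecMulVec_mul, Matrix.star_mulVec, hK]
  rw [optimalState, ← hRdef, Matrix.mul_assoc, hv, Matrix.mul_vecMulVec]
  ext p q
  simp only [Matrix.smul_apply, Matrix.vecMulVec_apply, Pi.star_apply, hψ, smul_eq_mul, star_mul',
    Complex.star_def, Complex.conj_ofReal]
  calc _ = (Fintype.card n : ℂ) * ((((Real.sqrt (Fintype.card n))⁻¹ : ℝ) : ℂ) *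
        (((Real.sqrt (Fintype.card n))⁻¹ : ℝ) : ℂ)) *
        (R p.2 p.1 * (starRingEnd ℂ) (R q.2 q.1)) := by ring
    _ = _ := by rw [hs, mul_inv_cancel₀ hd, one_mul]

theorem isState_optimalState [Nonempty n] {η : Matrix n n ℂ} (hη : 0 ≤ η) (h1 : η.trace = 1) :
    IsState (optimalState η) := by
  have hR : (CFC.sqrt η)ᴴ = CFC.sqrt η := (CFC.sqrt_nonneg η).isSelfAdjoint
  rw [optimalState_eq]
  refine ⟨Matrix.posSemidef_vecMulVec_self_star _, ?_⟩
  calc _ = (CFC.sqrt η * (CFC.sqrt η)ᴴ).trace := by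
        simp only [Matrix.trace, Matrix.diag_apply, Matrix.vecMulVec_apply, Pi.star_apply,
          Fintype.sum_prod_type, Matrix.mul_apply, Matrix.conjTranspose_apply]
        exact Finset.sum_comm
    _ = 1 := by rw [hR, CFC.sqrt_mul_sqrt_self η hη, h1]

/-- Measuring `A` on `ρ_η` steers Bob to `η^{1/2} Aᵀ η^{1/2}`. -/
theorem steeringMap_optimalState [Nonempty n] (η M : Matrix n n ℂ) :
    steeringMap (optimalState η) M = CFC.sqrt η * Mᵀ * CFC.sqrt η := by
  have hR : (CFC.sqrt η)ᴴ = CFC.sqrt η := (CFC.sqrt_nonneg η).isSelfAdjoint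
  calc _ = CFC.sqrt η * Mᵀ * (CFC.sqrt η)ᴴ := by
        ext j l
        rw [steeringMap_apply, optimalState_eq]
        simp only [Matrix.vecMulVec_apply, Pi.star_apply, Matrix.mul_apply,
          Matrix.transpose_apply, Matrix.conjTranspose_apply, Finset.sum_mul]
        refine Finset.sum_congr rfl fun i _ => Finset.sum_congr rfl fun k _ => ?_
        ring
    _ = _ := by rw [hR]

/-- A Hermitian matrix has a pseudo-inverse: `RS = SR` is the projection onto the range of `R`. -/
theorem exists_pseudoInverse {R : Matrix n n ℂ} (hR : Rᴴ = R) :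
    ∃ S : Matrix n n ℂ, Sᴴ = S ∧ R * S = S * R ∧ R * S * R = R := by
  have hsa : IsSelfAdjoint R := hR
  have hc : ∀ f : ℝ → ℝ, ContinuousOn f (spectrum ℝ R) := fun f =>
    (Matrix.finite_real_spectrum (A := R)).continuousOn f
  have hid : cfc (fun x : ℝ => x) R = R := cfc_id' ℝ R
  refine ⟨cfc (fun x : ℝ => x⁻¹) R, (cfc_predicate (fun x : ℝ => x⁻¹) R : IsSelfAdjoint _), ?_, ?_⟩
  · have h1 := cfc_mul (fun x : ℝ => x) (fun x : ℝ => x⁻¹) R (hc _) (hc _)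
    have h2 := cfc_mul (fun x : ℝ => x⁻¹) (fun x : ℝ => x) R (hc _) (hc _)
    rw [hid] at h1 h2
    rw [← h1, ← h2]
    simp only [mul_comm]
  · have h1 := cfc_mul (fun x : ℝ => x) (fun x : ℝ => x⁻¹) R (hc _) (hc _)
    have h2 := cfc_mul (fun x : ℝ => x * x⁻¹) (fun x : ℝ => x) R (hc _) (hc _)
    rw [hid] at h1 h2
    rw [← h1, ← h2]
    simpa only [mul_inv_mul_cancel] using hid

end optimalState

/-! ### The semidefinite program: weak duality -/

section weakDuality

variable {n X O : Type*} [Fintype n] [Fintype X]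

theorem SDPFeasible.nonneg [Nonempty O] {ω : X → O → Matrix n n ℂ} {η : Matrix n n ℂ}
    (h : SDPFeasible ω η) : 0 ≤ η := by
  obtain ⟨o⟩ := ‹Nonempty O›
  exact (Finset.sum_nonneg fun x _ => (h.1 x o).nonneg).trans (h.2.2 fun _ => o)

theorem SDPFeasible.le {ω : X → O → Matrix n n ℂ} {η : Matrix n n ℂ} (h : SDPFeasible ω η)
    (x : X) (a : O) : ω x a ≤ η :=
  (Finset.single_le_sum (f := fun y => ω y a) (fun y _ => (h.1 y a).nonneg)
    (Finset.mem_univ x)).trans (h.2.2 fun _ => a)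

theorem sdpValue_eq_sum [Fintype O] (B ω : X → O → Matrix n n ℂ) :
    sdpValue B ω = ∑ x, ∑ a, (ω x a * B x a).trace.re := by
  simp only [sdpValue, Matrix.trace_sum, Complex.re_sum]

theorem sdpValue_smul [Fintype O] (c : ℝ) (B ω : X → O → Matrix n n ℂ) :
    sdpValue B (fun x a => c • ω x a) = c * sdpValue B ω := by
  simp only [sdpValue_eq_sum, Matrix.smul_mul, trace_real_smul, Complex.re_ofReal_mul,
    Finset.mul_sum]

/-- Every setting contributes at most `1` to the value of the program. -/
theorem sdpValue_le_card [DecidableEq n] [Fintype O] {ω : X → O → Matrix n n ℂ} {η : Matrix n n ℂ}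
    (h : SDPFeasible ω η) {B : X → O → Matrix n n ℂ} (hB : IsMeasurementAssemblage B) :
    sdpValue B ω ≤ Fintype.card X := by
  rw [sdpValue_eq_sum]
  calc _ ≤ ∑ _x : X, (1 : ℝ) := Finset.sum_le_sum fun x _ => ?_
    _ = Fintype.card X := by simp
  calc ∑ a, (ω x a * B x a).trace.re ≤ ∑ a, (η * B x a).trace.re :=
        Finset.sum_le_sum fun a _ => re_trace_mul_le_mul_right (hB.1 x a).nonneg (h.le x a)
    _ = 1 := by
        rw [← Complex.re_sum, ← Matrix.trace_sum, ← Finset.mul_sum, hB.2, mul_one, h.2.1,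
          Complex.one_re]

omit [Fintype n] [Fintype X] in
theorem isMeasurementAssemblage_transpose [DecidableEq n] [Fintype O] {A : X → O → Matrix n n ℂ}
    (hA : IsMeasurementAssemblage A) : IsMeasurementAssemblage fun x a => (A x a)ᵀ :=
  ⟨fun x a => (hA.1 x a).transpose, fun x => by
    rw [← Matrix.transpose_sum, hA.2, Matrix.transpose_one]⟩

/-- If `0 ≤ ω ≤ η`, then `ω` is supported on the range of `η`. -/
theorem mul_eq_zero_of_le {ω η Q : Matrix n n ℂ} (hω : 0 ≤ ω) (h : ω ≤ η) (hQ : η * Q = 0) :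
    ω * Q = 0 := by
  classical
  have h1 : Qᴴ * ω * Q = 0 := by
    have h0 : 0 ≤ Qᴴ * ω * Q :=
      ((Matrix.nonneg_iff_posSemidef.mp hω).conjTranspose_mul_mul_same Q).nonneg
    have h2 := ((Matrix.le_iff.mp h).conjTranspose_mul_mul_same Q).nonneg
    rw [Matrix.mul_sub, Matrix.sub_mul, Matrix.mul_assoc Qᴴ η, hQ, Matrix.mul_zero, zero_sub] at h2
    exact le_antisymm (neg_nonneg.mp h2) h0
  obtain ⟨C, rfl⟩ := CStarAlgebra.nonneg_iff_eq_star_mul_self.mp hω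
  rw [Matrix.star_eq_conjTranspose] at h1 ⊢
  have h3 : (C * Q)ᴴ * (C * Q) = 0 := by
    rw [Matrix.conjTranspose_mul, ← h1]
    simp only [Matrix.mul_assoc]
  rw [Matrix.mul_assoc, Matrix.conjTranspose_mul_self_eq_zero.mp h3, Matrix.mul_zero]

variable [DecidableEq n] [Nonempty n] [DecidableEq X] [Nonempty X] [Fintype O] [DecidableEq O]
  [Nonempty O]

/-- A feasible pair `(ω, η)` bounds the steering robustness of `ρ_η` from below. With a
pseudo-inverse `S` of `η^{1/2}`, the operators `S ω S` form a steering inequality whose value on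
the assemblage `η^{1/2} Aᵀ η^{1/2}` is `tr ∑ ω Aᵀ`, because `ω ≤ η` is supported on the range of
`η`. -/
theorem sdpValue_le_of_mem_steeringSet {A ω : X → O → Matrix n n ℂ} {η : Matrix n n ℂ}
    (hA : IsMeasurementAssemblage A) (h : SDPFeasible ω η) {t : ℝ}
    (ht : t ∈ steeringSet (steeredAssemblage A (optimalState η))) :
    sdpValue (fun x a => (A x a)ᵀ) ω ≤ 1 + t := by
  have hη := h.nonneg
  obtain ⟨G, hG, hGt, hGA⟩ := (mem_steeringSet_iff (isStateAssemblage_steeredAssemblage hA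
    (isState_optimalState hη h.2.1))).mp ht
  have hR : (CFC.sqrt η)ᴴ = CFC.sqrt η := (CFC.sqrt_nonneg η).isSelfAdjoint
  have hRR : CFC.sqrt η * CFC.sqrt η = η := CFC.sqrt_mul_sqrt_self η hη
  simp only [steeredAssemblage_apply, steeringMap_optimalState] at hGA
  generalize CFC.sqrt η = R at hR hRR hGA
  obtain ⟨S, hS, hRS, hRSR⟩ := exists_pseudoInverse hR
  have hP : (R * S)ᴴ = R * S := by rw [Matrix.conjTranspose_mul, hS, hR, hRS]
  have hPP : R * S * (R * S) = R * S := by rw [← Matrix.mul_assoc, hRSR]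
  have hP1 : R * S ≤ 1 := by
    have h1 := (Matrix.posSemidef_conjTranspose_mul_self (1 - R * S)).nonneg
    rwa [Matrix.conjTranspose_sub, Matrix.conjTranspose_one, hP, Matrix.mul_sub, Matrix.sub_mul,
      Matrix.sub_mul, hPP, one_mul, mul_one, one_mul, sub_self, sub_zero, sub_nonneg] at h1
  have hηP : η * (1 - R * S) = 0 := by
    rw [Matrix.mul_sub, mul_one, ← hRR, hRS, Matrix.mul_assoc, ← Matrix.mul_assoc R S R, hRSR,
      sub_self]
  have hωP : ∀ x a, ω x a * (R * S) = ω x a := by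
    intro x a
    have h1 := mul_eq_zero_of_le (h.1 x a).nonneg (h.le x a) hηP
    rw [Matrix.mul_sub, mul_one, sub_eq_zero] at h1
    exact h1.symm
  have hPω : ∀ x a, R * S * ω x a = ω x a := by
    intro x a
    have h1 := congrArg Matrix.conjTranspose (hωP x a)
    rwa [Matrix.conjTranspose_mul, hP, (h.1 x a).isHermitian.eq] at h1
  have hF : ∀ x a, 0 ≤ S * ω x a * S := by
    intro x a
    have h1 := ((h.1 x a).mul_mul_conjTranspose_same S).nonneg
    rwa [hS] at h1
  have hFs : ∀ s : X → O, ∑ x, S * ω x (s x) * S ≤ 1 := by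
    intro s
    rw [← Finset.sum_mul, ← Finset.mul_sum]
    have h1 := ((h.2.2 s).mul_mul_conjTranspose_same S).nonneg
    rw [hS, Matrix.mul_sub, Matrix.sub_mul, sub_nonneg] at h1
    refine (h1.trans_eq ?_).trans hP1
    rw [← hRR, ← Matrix.mul_assoc, ← hRS, Matrix.mul_assoc, hPP]
  have hval : ∀ x a, (ω x a * (A x a)ᵀ).trace = (S * ω x a * S * (R * (A x a)ᵀ * R)).trace := by
    intro x a
    calc (ω x a * (A x a)ᵀ).trace = (R * S * ω x a * (R * S) * (A x a)ᵀ).trace := by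
          rw [hPω, hωP]
      _ = (R * (S * ω x a * S * R * (A x a)ᵀ)).trace := by
          rw [hRS]
          simp only [Matrix.mul_assoc]
          rw [← Matrix.mul_assoc S R, ← hRS]
          simp only [Matrix.mul_assoc]
      _ = _ := by
          rw [Matrix.trace_mul_comm]
          simp only [Matrix.mul_assoc]
  calc sdpValue (fun x a => (A x a)ᵀ) ω
      = ∑ x, ∑ a, (S * ω x a * S * (R * (A x a)ᵀ * R)).trace.re := by
        simp only [sdpValue_eq_sum, hval]
    _ ≤ ∑ x, ∑ a, (S * ω x a * S * coarseGraining G x a).trace.re :=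
        Finset.sum_le_sum fun x _ => Finset.sum_le_sum fun a _ =>
          re_trace_mul_le_mul_left (hF x a) (hGA x a)
    _ = ∑ s : X → O, ((∑ x, S * ω x (s x) * S) * G s).trace.re := by
        rw [← Complex.re_sum, ← sum_trace_mul_coarseGraining (fun x a => S * ω x a * S) G,
          ← sdpValue_eq_sum, sdpValue]
    _ ≤ ∑ s : X → O, (1 * G s).trace.re := by
        refine Finset.sum_le_sum fun s _ => ?_
        exact re_trace_mul_le_mul_right (hG s) (hFs s)
    _ = 1 + t := by
        rw [← hGt, Matrix.trace_sum, Complex.re_sum]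
        simp only [one_mul]

end weakDuality

/-! ### The semidefinite program: strong duality -/

section strongDuality

variable {n X O : Type*} [Fintype n] [Fintype X] [Fintype O]

omit [Fintype O] in
theorem sdpFeasible_zero [DecidableEq n] [Nonempty n] :
    SDPFeasible (fun _ _ => 0 : X → O → Matrix n n ℂ)
      ((Fintype.card n : ℝ)⁻¹ • (1 : Matrix n n ℂ)) := by
  refine ⟨fun _ _ => Matrix.PosSemidef.zero, ?_, fun s => ?_⟩
  · rw [trace_real_smul, Matrix.trace_one, Complex.ofReal_inv, Complex.ofReal_natCast,
      inv_mul_cancel₀ (Nat.cast_ne_zero.mpr Fintype.card_ne_zero)]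
  · rw [Finset.sum_const_zero, sub_zero]
    exact Matrix.PosSemidef.one.smul (by positivity)

/-- The program has an optimal solution, by compactness of its feasible region. -/
theorem exists_sdpFeasible_isMax [DecidableEq n] [Nonempty n] [Nonempty O]
    (B : X → O → Matrix n n ℂ) :
    ∃ (ω : X → O → Matrix n n ℂ) (η : Matrix n n ℂ), SDPFeasible ω η ∧
      ∀ (ω' : X → O → Matrix n n ℂ) (η' : Matrix n n ℂ), SDPFeasible ω' η' →
        sdpValue B ω' ≤ sdpValue B ω := by
  -- a pair `(ω, η)` is encoded as one family, with `η` at the index `none`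
  let Ω : (Option (X × O) → Matrix n n ℂ) → X → O → Matrix n n ℂ := fun W x a => W (some (x, a))
  have hΩ : ∀ x a, Continuous fun W => Ω W x a := fun x a => continuous_apply _
  let K : Set (Option (X × O) → Matrix n n ℂ) :=
    {W | ∀ s, 0 ≤ W s ∧ (W s).trace.re ≤ 1} ∩ {W | SDPFeasible (Ω W) (W none)}
  have hK : IsCompact K := by
    refine (isCompact_setOf_nonneg_trace_le n _ 1).inter_right ?_
    simp only [SDPFeasible, Set.ofPred_and, Set.ofPred_forall]
    refine IsClosed.inter (isClosed_iInter fun x => isClosed_iInter fun a => ?_)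
      (IsClosed.inter ?_ (isClosed_iInter fun s => ?_))
    · simp only [← Matrix.nonneg_iff_posSemidef]
      exact isClosed_setOf_matrix_le continuous_const (hΩ x a)
    · exact isClosed_eq (continuous_apply none).matrix_trace continuous_const
    · simp only [← Matrix.le_iff]
      exact isClosed_setOf_matrix_le (continuous_finsetSum _ fun x _ => hΩ x _)
        (continuous_apply none)
  have hmem : ∀ (ω : X → O → Matrix n n ℂ) (η : Matrix n n ℂ), SDPFeasible ω η →
      (fun o => o.elim η fun p => ω p.1 p.2) ∈ K := by
    intro ω η h
    refine ⟨?_, h⟩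
    rintro (_ | ⟨x, a⟩)
    · exact ⟨h.nonneg, by simp [h.2.1]⟩
    · refine ⟨(h.1 x a).nonneg, ?_⟩
      have h1 := re_trace_nonneg (sub_nonneg.mpr (h.le x a))
      rw [Matrix.trace_sub, h.2.1, Complex.sub_re, Complex.one_re] at h1
      simpa using h1
  obtain ⟨W, hW, hmax⟩ := hK.exists_isMaxOn ⟨_, hmem _ _ sdpFeasible_zero⟩
    (f := fun W => sdpValue B (Ω W)) (by
      refine (continuous_re_trace ?_).continuousOn
      exact continuous_finsetSum _ fun x _ => continuous_finsetSum _ fun a _ =>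
        (hΩ x a).matrix_mul continuous_const)
  have hmax' : ∀ W' ∈ K, sdpValue B (Ω W') ≤ sdpValue B (Ω W) := isMaxOn_iff.mp hmax
  refine ⟨Ω W, W none, hW.2, fun ω' η' h' => ?_⟩
  have h1 := hmax' _ (hmem ω' η' h')
  have h2 : Ω (fun o => o.elim η' fun p => ω' p.1 p.2) = ω' := rfl
  rwa [h2] at h1

/-- Every real linear functional on matrices is the trace pairing with a Hermitian matrix, as far
as Hermitian arguments are concerned. -/
theorem exists_isHermitian_re_trace_mul [DecidableEq n] (f : Matrix n n ℂ →ₗ[ℝ] ℝ) :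
    ∃ W : Matrix n n ℂ, W.IsHermitian ∧ ∀ M : Matrix n n ℂ, M.IsHermitian →
      f M = (W * M).trace.re := by
  let V : Matrix n n ℂ := fun j i =>
    (f (Matrix.single i j 1) : ℂ) - f (Matrix.single i j Complex.I) * Complex.I
  have hV : ∀ M, f M = (V * M).trace.re := by
    intro M
    have hs : ∀ i j, f (Matrix.single i j (M i j)) = (V j i * M i j).re := by
      intro i j
      have h1 : Matrix.single i j (M i j) = (M i j).re • Matrix.single i j (1 : ℂ)
          + (M i j).im • Matrix.single i j Complex.I := by
        rw [Matrix.smul_single, Matrix.smul_single, ← Matrix.single_add]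
        congr 1
        rw [Complex.real_smul, Complex.real_smul, mul_one, Complex.re_add_im]
      rw [h1, map_add, map_smul, map_smul]
      simp only [V, smul_eq_mul, Complex.mul_re, Complex.sub_re, Complex.sub_im, Complex.ofReal_re,
        Complex.ofReal_im, Complex.I_re, Complex.I_im, Complex.mul_im]
      ring
    conv_lhs => rw [Matrix.matrix_eq_sum_single M]
    simp only [map_sum, hs, Matrix.trace, Matrix.diag_apply, Matrix.mul_apply, Complex.re_sum]
    exact Finset.sum_comm
  refine ⟨(2⁻¹ : ℝ) • (V + Vᴴ), ?_, fun M hM => ?_⟩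
  · rw [Matrix.IsHermitian, Matrix.conjTranspose_smul, Matrix.conjTranspose_add,
      Matrix.conjTranspose_conjTranspose, add_comm, star_trivial]
  · have h1 : (Vᴴ * M).trace.re = (V * M).trace.re := by
      have h2 : Vᴴ * M = (M * V)ᴴ := by rw [Matrix.conjTranspose_mul, hM.eq]
      rw [h2, Matrix.trace_conjTranspose, Complex.star_def, Complex.conj_re, Matrix.trace_mul_comm]
    rw [hV, Matrix.smul_mul, trace_real_smul, Complex.re_ofReal_mul, Matrix.add_mul,
      Matrix.trace_add, Complex.add_re, h1]
    ring

/-- The cone of positive semidefinite matrices is self-dual. -/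
theorem nonneg_of_re_trace_mul_nonneg {W : Matrix n n ℂ} (hW : W.IsHermitian)
    (h : ∀ M : Matrix n n ℂ, 0 ≤ M → 0 ≤ (W * M).trace.re) : 0 ≤ W := by
  refine Matrix.nonneg_iff_posSemidef.mpr
    (Matrix.posSemidef_iff_dotProduct_mulVec.mpr ⟨hW, fun v => ?_⟩)
  have h1 := h _ (Matrix.posSemidef_vecMulVec_self_star v).nonneg
  rw [Matrix.mul_vecMulVec, Matrix.trace_vecMulVec, dotProduct_comm] at h1
  refine Complex.le_def.mpr ⟨h1, ?_⟩
  exact (hW.im_star_dotProduct_mulVec_self v).symm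

variable [DecidableEq X] [DecidableEq O]

/-- The cone of all `(Y, Z)` for which there are `G_s ≥ 0` with `Y_{a|x} ≤ ∑_s δ_{a,s(x)} G_s` and
`∑_s G_s ≤ Z`. -/
def dominatedCone (n X O : Type*) [Fintype X] [DecidableEq X] [Fintype O] [DecidableEq O] :
    Set ((X → O → Matrix n n ℂ) × Matrix n n ℂ) :=
  {e | ∃ G : (X → O) → Matrix n n ℂ, (∀ s, 0 ≤ G s) ∧
    (∀ x a, e.1 x a ≤ coarseGraining G x a) ∧ ∑ s, G s ≤ e.2}

/-- The cone is closed because the trace of `Z` bounds the operators `G_s`, so that these may be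
extracted from a compact set. -/
theorem isClosed_dominatedCone : IsClosed (dominatedCone n X O) := by
  classical
  refine isClosed_iff_ultrafilter.mpr fun e u hu hK => ?_
  have hex : ∀ e' : (X → O → Matrix n n ℂ) × Matrix n n ℂ,
      ∃ G : (X → O) → Matrix n n ℂ, e' ∈ dominatedCone n X O →
        (∀ s, 0 ≤ G s) ∧ (∀ x a, e'.1 x a ≤ coarseGraining G x a) ∧ ∑ s, G s ≤ e'.2 := by
    intro e'
    by_cases h : e' ∈ dominatedCone n X O
    · obtain ⟨G, hG⟩ := h
      exact ⟨G, fun _ => hG⟩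
    · exact ⟨0, fun h' => absurd h' h⟩
  choose g hg using hex
  have hlt : ∀ᶠ e' in (u : Filter ((X → O → Matrix n n ℂ) × Matrix n n ℂ)),
      e'.2.trace.re < e.2.trace.re + 1 :=
    hu (((continuous_re_trace continuous_snd).tendsto e).eventually_lt_const
      (lt_add_one e.2.trace.re))
  have hbd : ∀ᶠ e' in (u : Filter ((X → O → Matrix n n ℂ) × Matrix n n ℂ)),
      g e' ∈ {G : (X → O) → Matrix n n ℂ |
        ∀ s, 0 ≤ G s ∧ (G s).trace.re ≤ e.2.trace.re + 1} := by
    filter_upwards [hK, hlt] with e' h1 h2 s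
    obtain ⟨hG, -, hGZ⟩ := hg e' h1
    have h3 := re_trace_nonneg (sub_nonneg.mpr hGZ)
    rw [Matrix.trace_sub, Complex.sub_re] at h3
    exact ⟨hG s, by linarith [re_trace_le_re_trace_sum hG s]⟩
  obtain ⟨G₀, -, hG₀⟩ := (isCompact_setOf_nonneg_trace_le n (X → O)
    (e.2.trace.re + 1)).ultrafilter_le_nhds' (u.map g) hbd
  have hlim : Filter.Tendsto (fun e' => (g e', e')) u (nhds (G₀, e)) :=
    Filter.Tendsto.prodMk_nhds hG₀ hu
  have hS : IsClosed {q : ((X → O) → Matrix n n ℂ) × ((X → O → Matrix n n ℂ) × Matrix n n ℂ) |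
      (∀ s, 0 ≤ q.1 s) ∧ (∀ x a, q.2.1 x a ≤ coarseGraining q.1 x a) ∧ ∑ s, q.1 s ≤ q.2.2} := by
    simp only [Set.ofPred_and, Set.ofPred_forall]
    refine IsClosed.inter (isClosed_iInter fun s => ?_) (IsClosed.inter
      (isClosed_iInter fun x => isClosed_iInter fun a => ?_) ?_)
    · exact isClosed_setOf_matrix_le continuous_const (by fun_prop)
    · exact isClosed_setOf_matrix_le (by fun_prop)
        ((continuous_coarseGraining x a).comp continuous_fst)
    · exact isClosed_setOf_matrix_le (by fun_prop) (by fun_prop)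
  have hmem := hS.mem_of_tendsto hlim (Filter.mem_of_superset hK fun e' he' => hg e' he')
  exact ⟨G₀, hmem⟩

/-- `dominatedCone` as a closed convex cone. -/
noncomputable def dominatedProperCone (n X O : Type*) [Fintype n] [Fintype X] [DecidableEq X]
    [Fintype O] [DecidableEq O] : ProperCone ℝ ((X → O → Matrix n n ℂ) × Matrix n n ℂ) where
  carrier := dominatedCone n X O
  zero_mem' := ⟨0, fun _ => le_rfl, fun _ _ => by simp [coarseGraining], by simp⟩
  add_mem' := by
    rintro e e' ⟨G, hG, hGY, hGZ⟩ ⟨G', hG', hGY', hGZ'⟩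
    refine ⟨G + G', fun s => add_nonneg (hG s) (hG' s), fun x a => ?_, ?_⟩
    · have h := add_le_add (hGY x a) (hGY' x a)
      simpa only [coarseGraining, ← Finset.sum_add_distrib] using! h
    · have h := add_le_add hGZ hGZ'
      simpa only [← Finset.sum_add_distrib] using! h
  smul_mem' := by
    rintro ⟨c, hc⟩ e ⟨G, hG, hGY, hGZ⟩
    refine ⟨fun s => c • G s, fun s => real_smul_nonneg hc (hG s), fun x a => ?_, ?_⟩
    · have h := real_smul_nonneg hc (sub_nonneg.mpr (hGY x a))
      rw [smul_sub, sub_nonneg, ← coarseGraining_smul] at h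
      exact h
    · have h := real_smul_nonneg hc (sub_nonneg.mpr hGZ)
      rw [smul_sub, sub_nonneg, Finset.smul_sum] at h
      exact h
  isClosed' := isClosed_dominatedCone

/-- Strong duality. If `μ` bounds all values of the program, then `(A, μ 𝟙)` lies in the closed
cone `dominatedCone`, since a separating functional would be a feasible point with a value
exceeding `μ`. -/
theorem exists_coarseGraining_of_sdpValue_le [DecidableEq n] {A : X → O → Matrix n n ℂ}
    (hA : ∀ x a, 0 ≤ A x a) {μ : ℝ}
    (h : ∀ (ω : X → O → Matrix n n ℂ) (η : Matrix n n ℂ), SDPFeasible ω η → sdpValue A ω ≤ μ) :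
    ∃ G : (X → O) → Matrix n n ℂ, (∀ s, 0 ≤ G s) ∧
      (∀ x a, A x a ≤ coarseGraining G x a) ∧ ∑ s, G s ≤ μ • (1 : Matrix n n ℂ) := by
  by_contra hno
  have : LocallyConvexSpace ℝ (Matrix n n ℂ) :=
    inferInstanceAs (LocallyConvexSpace ℝ (n → n → ℂ))
  obtain ⟨f, hf, hfA⟩ := (dominatedProperCone n X O).hyperplane_separation_point
    (x₀ := (A, μ • (1 : Matrix n n ℂ))) hno
  let ι₁ : X → O → Matrix n n ℂ →ₗ[ℝ] (X → O → Matrix n n ℂ) × Matrix n n ℂ := fun x a =>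
    (LinearMap.inl ℝ _ _).comp ((LinearMap.single ℝ (fun _ : X => O → Matrix n n ℂ) x).comp
      (LinearMap.single ℝ (fun _ : O => Matrix n n ℂ) a))
  let ι₂ : Matrix n n ℂ →ₗ[ℝ] (X → O → Matrix n n ℂ) × Matrix n n ℂ := LinearMap.inr ℝ _ _
  have hsplit : ∀ (Y : X → O → Matrix n n ℂ) (Z : Matrix n n ℂ),
      f (Y, Z) = (∑ x, ∑ a, f (ι₁ x a (Y x a))) + f (ι₂ Z) := by
    intro Y Z
    have h1 : (Y, Z) = (∑ x, ∑ a, ι₁ x a (Y x a)) + ι₂ Z := by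
      refine Prod.ext ?_ ?_
      · funext y b
        simp only [ι₁, ι₂, Prod.fst_add, Prod.fst_sum, LinearMap.comp_apply, LinearMap.inl_apply,
          LinearMap.inr_apply, LinearMap.single_apply, Pi.add_apply, Finset.sum_apply,
          Pi.zero_apply, add_zero]
        rw [Finset.sum_eq_single y (fun x _ hx => by simp [Pi.single_eq_of_ne hx.symm]) (by simp),
          Finset.sum_eq_single b (fun a _ ha => by simp [Pi.single_eq_of_ne ha.symm]) (by simp)]
        simp
      · simp [ι₁, ι₂, Prod.snd_sum]
    rw [h1, map_add, map_sum]
    simp only [map_sum]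
  choose W hW hWf using fun x a =>
    exists_isHermitian_re_trace_mul (f.toLinearMap.comp (ι₁ x a))
  obtain ⟨η, hη, hηf⟩ := exists_isHermitian_re_trace_mul (f.toLinearMap.comp ι₂)
  have hf' : ∀ (Y : X → O → Matrix n n ℂ) (Z : Matrix n n ℂ), (∀ x a, (Y x a).IsHermitian) →
      Z.IsHermitian → f (Y, Z) = (∑ x, ∑ a, (W x a * Y x a).trace.re) + (η * Z).trace.re := by
    intro Y Z hY hZ
    rw [hsplit, ← hηf Z hZ]
    simp only [← hWf _ _ _ (hY _ _)]
    rfl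
  have hω : ∀ x a, 0 ≤ -W x a := by
    intro x a
    refine nonneg_of_re_trace_mul_nonneg (hW x a).neg fun M hM => ?_
    have hmem : ι₁ x a (-M) ∈ dominatedProperCone n X O := by
      refine ⟨0, fun _ => le_rfl, fun y b => ?_, by simp [ι₁]⟩
      have h0 : coarseGraining (0 : (X → O) → Matrix n n ℂ) y b = 0 := by simp [coarseGraining]
      rw [h0]
      by_cases hy : y = x
      · subst hy
        by_cases hb : b = a
        · subst hb
          simpa [ι₁] using hM
        · simp [ι₁, Pi.single_eq_of_ne hb]
      · simp [ι₁, Pi.single_eq_of_ne hy]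
    have h1 : f (ι₁ x a (-M)) = (W x a * -M).trace.re :=
      hWf x a (-M) (Matrix.nonneg_iff_posSemidef.mp hM).isHermitian.neg
    rw [Matrix.neg_mul, ← Matrix.mul_neg, ← h1]
    exact hf _ hmem
  have hη0 : 0 ≤ η := by
    refine nonneg_of_re_trace_mul_nonneg hη fun M hM => ?_
    have hmem : ι₂ M ∈ dominatedProperCone n X O :=
      ⟨0, fun _ => le_rfl, fun y b => by simp [ι₂, coarseGraining], by simpa [ι₂] using hM⟩
    have h1 : f (ι₂ M) = (η * M).trace.re :=
      hηf M (Matrix.nonneg_iff_posSemidef.mp hM).isHermitian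
    rw [← h1]
    exact hf _ hmem
  have hs : ∀ s : X → O, ∑ x, -W x (s x) ≤ η := by
    intro s
    rw [← sub_nonneg, Finset.sum_neg_distrib, sub_neg_eq_add]
    have hherm : (η + ∑ x, W x (s x)).IsHermitian := by
      refine hη.add ?_
      rw [Matrix.IsHermitian, Matrix.conjTranspose_sum]
      exact Finset.sum_congr rfl fun x _ => (hW x _).eq
    refine nonneg_of_re_trace_mul_nonneg hherm fun M hM => ?_
    let G : (X → O) → Matrix n n ℂ := Pi.single s M
    have hG : ∀ s', 0 ≤ G s' := by
      intro s'
      by_cases h1 : s' = s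
      · subst h1
        simpa [G] using hM
      · simp [G, Pi.single_eq_of_ne h1]
    have hsum : ∑ s', G s' = M := by simp [G]
    have h1 := hf (fun x a => coarseGraining G x a, M)
      ⟨G, hG, fun _ _ => le_rfl, hsum.le⟩
    rw [hf' _ _ (fun x a => (Matrix.nonneg_iff_posSemidef.mp
      (coarseGraining_nonneg hG x a)).isHermitian)
      (Matrix.nonneg_iff_posSemidef.mp hM).isHermitian, ← sdpValue_eq_sum, sdpValue,
      sum_trace_mul_coarseGraining, Complex.re_sum, Finset.sum_eq_single s
        (fun s' _ hs' => by simp [G, Pi.single_eq_of_ne hs']) (by simp)] at h1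
    simp only [G, Pi.single_eq_same] at h1
    rw [Matrix.add_mul, Matrix.trace_add, Complex.add_re]
    linarith
  have hlt : μ * η.trace.re < sdpValue A fun x a => -W x a := by
    rw [hf' _ _ (fun x a => (Matrix.nonneg_iff_posSemidef.mp (hA x a)).isHermitian)
      (by rw [Matrix.IsHermitian, Matrix.conjTranspose_smul, Matrix.conjTranspose_one,
        star_trivial]), Matrix.mul_smul, mul_one, trace_real_smul, Complex.re_ofReal_mul] at hfA
    rw [sdpValue_eq_sum]
    simp only [Matrix.neg_mul, Matrix.trace_neg, Complex.neg_re, Finset.sum_neg_distrib]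
    linarith
  rcases (re_trace_nonneg hη0).eq_or_lt with h0 | hpos
  · -- `η = 0` would force `ω = 0` and leave no room for a strict inequality
    have hη00 := eq_zero_of_re_trace hη0 h0.ge
    have hW0 : ∀ x a, -W x a = 0 := by
      intro x a
      refine le_antisymm ?_ (hω x a)
      have h1 := hs fun _ => a
      rw [hη00] at h1
      exact (Finset.single_le_sum (f := fun y => -W y a) (fun y _ => hω y a)
        (Finset.mem_univ x)).trans h1
    rw [← h0, mul_zero, sdpValue_eq_sum] at hlt
    simp [hW0] at hlt
  · have hfeas : SDPFeasible (fun x a => (η.trace.re)⁻¹ • -W x a) ((η.trace.re)⁻¹ • η) := by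
      refine ⟨fun x a => Matrix.nonneg_iff_posSemidef.mp
        (real_smul_nonneg (inv_nonneg.mpr hpos.le) (hω x a)), ?_, fun s => ?_⟩
      · rw [trace_real_smul, trace_eq_re hη0, Complex.ofReal_re]
        exact_mod_cast inv_mul_cancel₀ hpos.ne'
      · rw [← Finset.smul_sum, ← smul_sub]
        exact Matrix.nonneg_iff_posSemidef.mp
          (real_smul_nonneg (inv_nonneg.mpr hpos.le) (sub_nonneg.mpr (hs s)))
    have h1 := h _ _ hfeas
    rw [sdpValue_smul, inv_mul_le_iff₀ hpos] at h1
    linarith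

end strongDuality

/-! ### The robustness as the optimal value of the program -/

section optimum

variable {n X O : Type*} [Fintype n] [DecidableEq n] [Nonempty n] [Fintype X] [Nonempty X]
  [Fintype O]

omit [Fintype X] in
theorem IsMeasurementAssemblage.nonempty_outcomes {A : X → O → Matrix n n ℂ}
    (hA : IsMeasurementAssemblage A) : Nonempty O := by
  by_contra h
  rw [not_nonempty_iff] at h
  obtain ⟨x⟩ := ‹Nonempty X›
  have h1 := hA.2 x
  rw [Finset.univ_eq_empty, Finset.sum_empty] at h1
  exact zero_ne_one h1

theorem SDPFeasible.isState_optimalState {A ω : X → O → Matrix n n ℂ} {η : Matrix n n ℂ}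
    (hA : IsMeasurementAssemblage A) (h : SDPFeasible ω η) : IsState (optimalState η) :=
  have := hA.nonempty_outcomes
  _root_.isState_optimalState h.nonneg h.2.1

/-- The value of a feasible point is a lower bound for the incompatibility robustness, because
steering with `ρ_η` is at most as robust as the incompatibility of `A`. -/
theorem sdpValue_le_of_mem_incompatibilitySet {A ω : X → O → Matrix n n ℂ} {η : Matrix n n ℂ}
    (hA : IsMeasurementAssemblage A) (h : SDPFeasible ω η) {t : ℝ}
    (ht : t ∈ incompatibilitySet A) : sdpValue (fun x a => (A x a)ᵀ) ω ≤ 1 + t := by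
  classical
  have := hA.nonempty_outcomes
  exact sdpValue_le_of_mem_steeringSet hA h
    (incompatibilitySet_subset_steeringSet hA (h.isState_optimalState hA) ht)

/-- An optimal solution of the program, together with the fact that its value is attained as
`1 + t` by an admissible noise parameter. -/
theorem exists_sdpFeasible_mem_incompatibilitySet {A : X → O → Matrix n n ℂ}
    (hA : IsMeasurementAssemblage A) :
    ∃ (ω : X → O → Matrix n n ℂ) (η : Matrix n n ℂ), SDPFeasible ω η ∧
      sdpValue (fun x a => (A x a)ᵀ) ω - 1 ∈ incompatibilitySet A := by
  classical
  have := hA.nonempty_outcomes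
  obtain ⟨ω, η, hfeas, hmax⟩ := exists_sdpFeasible_isMax fun x a => (A x a)ᵀ
  refine ⟨ω, η, hfeas, (mem_incompatibilitySet_iff hA).mpr ?_⟩
  obtain ⟨G, hG, hGA, hG1⟩ := exists_coarseGraining_of_sdpValue_le
    (fun x a => (hA.1 x a).transpose.nonneg) hmax
  rw [add_sub_cancel]
  generalize sdpValue (fun x a => (A x a)ᵀ) ω = μ at hG1
  have htr : ∀ M N : Matrix n n ℂ, Mᵀ ≤ N → M ≤ Nᵀ := by
    intro M N h
    have h1 := (Matrix.le_iff.mp h).transpose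
    rwa [Matrix.transpose_sub, Matrix.transpose_transpose] at h1
  have hG1' : 0 ≤ μ • (1 : Matrix n n ℂ) - ∑ s, (G s)ᵀ := by
    have h1 := (Matrix.le_iff.mp hG1).transpose.nonneg
    rwa [Matrix.transpose_sub, Matrix.transpose_smul, Matrix.transpose_one,
      Matrix.transpose_sum] at h1
  -- the slack in `∑ G_s ≤ μ 𝟙` may be given to any one strategy
  obtain ⟨s₀⟩ : Nonempty (X → O) := inferInstance
  let H : (X → O) → Matrix n n ℂ := fun s =>
    (G s)ᵀ + if s = s₀ then μ • (1 : Matrix n n ℂ) - ∑ s, (G s)ᵀ else 0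
  have hH : ∀ s, (G s)ᵀ ≤ H s := by
    intro s
    refine le_add_of_nonneg_right ?_
    split_ifs
    · exact hG1'
    · exact le_rfl
  refine ⟨H, fun s => (Matrix.nonneg_iff_posSemidef.mp (hG s)).transpose.nonneg.trans (hH s), ?_,
    fun x a => ?_⟩
  · simp [H, Finset.sum_add_distrib]
  · have h1 := htr _ _ (hGA x a)
    rw [coarseGraining, Matrix.transpose_sum] at h1
    exact h1.trans (Finset.sum_le_sum fun s _ => hH s)

theorem isLeast_of_mem_incompatibilitySet {A ω : X → O → Matrix n n ℂ} {η : Matrix n n ℂ}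
    (hA : IsMeasurementAssemblage A) (h : SDPFeasible ω η)
    (hmem : sdpValue (fun x a => (A x a)ᵀ) ω - 1 ∈ incompatibilitySet A) :
    IsLeast (incompatibilitySet A) (incompatibilityRobustness A) ∧
      sdpValue (fun x a => (A x a)ᵀ) ω = 1 + incompatibilityRobustness A := by
  have hl : IsLeast (incompatibilitySet A) (sdpValue (fun x a => (A x a)ᵀ) ω - 1) :=
    ⟨hmem, fun t ht => by linarith [sdpValue_le_of_mem_incompatibilitySet hA h ht]⟩
  have he : incompatibilityRobustness A = sdpValue (fun x a => (A x a)ᵀ) ω - 1 := hl.csInf_eq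
  exact ⟨he ▸ hl, by linarith⟩

theorem isLeast_incompatibilitySet {A : X → O → Matrix n n ℂ}
    (hA : IsMeasurementAssemblage A) :
    IsLeast (incompatibilitySet A) (incompatibilityRobustness A) := by
  obtain ⟨ω, η, h, hmem⟩ := exists_sdpFeasible_mem_incompatibilitySet hA
  exact (isLeast_of_mem_incompatibilitySet hA h hmem).1

theorem exists_sdpFeasible_eq {A : X → O → Matrix n n ℂ} (hA : IsMeasurementAssemblage A) :
    ∃ (ω : X → O → Matrix n n ℂ) (η : Matrix n n ℂ), SDPFeasible ω η ∧
      sdpValue (fun x a => (A x a)ᵀ) ω = 1 + incompatibilityRobustness A := by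
  obtain ⟨ω, η, h, hmem⟩ := exists_sdpFeasible_mem_incompatibilitySet hA
  exact ⟨ω, η, h, (isLeast_of_mem_incompatibilitySet hA h hmem).2⟩

theorem isLeast_steeringSet_steeredAssemblage {A : X → O → Matrix n n ℂ}
    (hA : IsMeasurementAssemblage A) {m : Type*} [Fintype m] [DecidableEq m]
    {ρ : Matrix (n × m) (n × m) ℂ} (hρ : IsState ρ) :
    IsLeast (steeringSet (steeredAssemblage A ρ)) (steeringRobustness (steeredAssemblage A ρ)) := by
  classical
  exact isLeast_steeringSet (isStateAssemblage_steeredAssemblage hA hρ)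
    ⟨_, incompatibilitySet_subset_steeringSet hA hρ (isLeast_incompatibilitySet hA).1⟩

theorem steeringRobustness_le {A : X → O → Matrix n n ℂ} (hA : IsMeasurementAssemblage A)
    {m : Type*} [Fintype m] [DecidableEq m] {ρ : Matrix (n × m) (n × m) ℂ} (hρ : IsState ρ) :
    steeringRobustness (steeredAssemblage A ρ) ≤ incompatibilityRobustness A := by
  classical
  exact (isLeast_steeringSet_steeredAssemblage hA hρ).2
    (incompatibilitySet_subset_steeringSet hA hρ (isLeast_incompatibilitySet hA).1)

theorem sdpValue_le_steeringRobustness {A ω : X → O → Matrix n n ℂ} {η : Matrix n n ℂ}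
    (hA : IsMeasurementAssemblage A) (h : SDPFeasible ω η) :
    sdpValue (fun x a => (A x a)ᵀ) ω ≤
      1 + steeringRobustness (steeredAssemblage A (optimalState η)) := by
  classical
  have := hA.nonempty_outcomes
  exact sdpValue_le_of_mem_steeringSet hA h
    (isLeast_steeringSet_steeredAssemblage hA (h.isState_optimalState hA)).1

omit [Nonempty X] [Fintype O] in
theorem SDPFeasible.fullRankPerturbation [Nonempty O] {ω : X → O → Matrix n n ℂ}
    {η : Matrix n n ℂ} (h : SDPFeasible ω η) {δ : ℝ} (hδ : 0 ≤ δ) (hδ1 : δ ≤ 1) :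
    SDPFeasible (fun x a => (1 - δ) • ω x a) (fullRankPerturbation δ η) := by
  refine ⟨fun x a => (h.1 x a).smul (sub_nonneg.mpr hδ1), ?_, fun s => ?_⟩
  · rw [_root_.fullRankPerturbation, Matrix.trace_add, trace_real_smul, trace_real_smul, h.2.1,
      Matrix.trace_one]
    have hd : (Fintype.card n : ℂ) ≠ 0 := Nat.cast_ne_zero.mpr Fintype.card_ne_zero
    push_cast
    field_simp
    ring
  · rw [_root_.fullRankPerturbation, add_comm, ← Finset.smul_sum, add_sub_assoc, ← smul_sub]
    exact (Matrix.PosSemidef.one.smul (by positivity)).add ((h.2.2 s).smul (sub_nonneg.mpr hδ1))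

theorem posDef_fullRankPerturbation {η : Matrix n n ℂ} (hη : 0 ≤ η) {δ : ℝ} (hδ : 0 < δ)
    (hδ1 : δ ≤ 1) : (fullRankPerturbation δ η).PosDef := by
  have hd : 0 < Fintype.card n := Fintype.card_pos
  exact Matrix.PosDef.posSemidef_add
    ((Matrix.nonneg_iff_posSemidef.mp hη).smul (sub_nonneg.mpr hδ1))
    (Matrix.PosDef.one.smul (by positivity))

/-- Mixing in `δ 𝟙 / d` costs at most `δ` per setting. -/
theorem fullRankPerturbation_spec {A ω : X → O → Matrix n n ℂ} {η : Matrix n n ℂ}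
    (hA : IsMeasurementAssemblage A) (h : SDPFeasible ω η) {ε δ : ℝ}
    (hv : 1 + incompatibilityRobustness A - ε / 2 ≤ sdpValue (fun x a => (A x a)ᵀ) ω)
    (hδ : 0 < δ) (hδ1 : δ ≤ 1) (hδε : δ * Fintype.card X ≤ ε / 2) :
    (fullRankPerturbation δ η).PosDef ∧ (fullRankPerturbation δ η).trace = 1 ∧
      IsState (optimalState (fullRankPerturbation δ η)) ∧
      incompatibilityRobustness A - ε ≤ steeringRobustness
        (steeredAssemblage A (optimalState (fullRankPerturbation δ η))) := by
  have := hA.nonempty_outcomes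
  have h' := h.fullRankPerturbation hδ.le hδ1
  refine ⟨posDef_fullRankPerturbation h.nonneg hδ hδ1, h'.2.1, h'.isState_optimalState hA, ?_⟩
  have h1 := sdpValue_le_steeringRobustness hA h'
  rw [sdpValue_smul] at h1
  have h2 := sdpValue_le_card h (isMeasurementAssemblage_transpose hA)
  have h3 := mul_le_mul_of_nonneg_left h2 hδ.le
  linarith

end optimum

/-! ### An assemblage for which maximally entangled states are not optimal -/

/-- The (unnormalised) eigenvectors of the Pauli matrices `Z` (setting `0`) and `X` (setting `1`)
on the span of the last two basis vectors of `ℂ⁴`. -/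
def pauliVector : Fin 2 → Fin 2 → Fin 4 → ℂ :=
  ![![![0, 0, 1, 0], ![0, 0, 0, 1]], ![![0, 0, 1, 1], ![0, 0, 1, -1]]]

/-- The sharp measurements of `Z` and `X` on the span of the last two basis vectors of `ℂ⁴`. -/
noncomputable def pauliEffect (x a : Fin 2) : Matrix (Fin 4) (Fin 4) ℂ :=
  (![1, 1 / 2] x : ℝ) • Matrix.vecMulVec (pauliVector x a) (star (pauliVector x a))

/-- The projection of `ℂ⁴` onto the span of the first two basis vectors. -/
def upperProj : Matrix (Fin 4) (Fin 4) ℂ := Matrix.diagonal ![1, 1, 0, 0]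

/-- The projection of `ℂ⁴` onto the span of the last two basis vectors. -/
def lowerProj : Matrix (Fin 4) (Fin 4) ℂ := Matrix.diagonal ![0, 0, 1, 1]

/-- The direct sum of a trivial assemblage (always outcome `0`) on the first two basis vectors of
`ℂ⁴` and of the incompatible assemblage `pauliEffect` on the last two. -/
noncomputable def blockAssemblage (x a : Fin 2) : Matrix (Fin 4) (Fin 4) ℂ :=
  pauliEffect x a + if a = 0 then upperProj else 0

theorem upperProj_nonneg : 0 ≤ upperProj := by
  refine (Matrix.PosSemidef.diagonal fun i => ?_).nonneg
  fin_cases i <;> simp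

theorem trace_upperProj : upperProj.trace = 2 := by
  simp [upperProj, Matrix.trace_diagonal, Fin.sum_univ_succ]
  norm_num

theorem trace_lowerProj : lowerProj.trace = 2 := by
  simp [lowerProj, Matrix.trace_diagonal, Fin.sum_univ_succ]
  norm_num

theorem lowerProj_conjTranspose : lowerProjᴴ = lowerProj := by
  rw [lowerProj, Matrix.diagonal_conjTranspose]
  congr 1
  ext i
  fin_cases i <;> simp

theorem lowerProj_mul_self : lowerProj * lowerProj = lowerProj := by
  rw [lowerProj, Matrix.diagonal_mul_diagonal]
  congr 1
  ext i
  fin_cases i <;> simp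

theorem pauliEffect_posSemidef (x a : Fin 2) : (pauliEffect x a).PosSemidef := by
  refine (Matrix.posSemidef_vecMulVec_self_star _).smul ?_
  fin_cases x <;> simp

theorem pauliEffect_apply (x a : Fin 2) (i j : Fin 4) :
    pauliEffect x a i j = ((![1, 1 / 2] x : ℝ) : ℂ) * (pauliVector x a i * pauliVector x a j) := by
  have h : star (pauliVector x a j) = pauliVector x a j := by
    fin_cases x <;> fin_cases a <;> fin_cases j <;> simp [pauliVector]
  rw [pauliEffect, Matrix.smul_apply, Matrix.vecMulVec_apply, Pi.star_apply, h, Complex.real_smul]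

theorem sum_pauliEffect (x : Fin 2) : ∑ a, pauliEffect x a = lowerProj := by
  ext i j
  simp only [Matrix.sum_apply, pauliEffect_apply, Fin.sum_univ_two]
  fin_cases x <;> fin_cases i <;> fin_cases j <;> norm_num [pauliVector, lowerProj]

theorem isMeasurementAssemblage_blockAssemblage : IsMeasurementAssemblage blockAssemblage := by
  refine ⟨fun x a => ?_, fun x => ?_⟩
  · refine (pauliEffect_posSemidef x a).add (Matrix.nonneg_iff_posSemidef.mp ?_)
    split_ifs
    · exact upperProj_nonneg
    · exact le_rfl
  · simp only [blockAssemblage, Finset.sum_add_distrib, sum_pauliEffect, Finset.sum_ite_eq',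
      Finset.mem_univ, if_true]
    rw [lowerProj, upperProj, Matrix.diagonal_add, ← Matrix.diagonal_one]
    congr 1
    ext i
    fin_cases i <;> simp

theorem lowerProj_mul_blockAssemblage_mul (x a : Fin 2) :
    lowerProj * blockAssemblage x a * lowerProj = pauliEffect x a := by
  ext i j
  rw [lowerProj, Matrix.mul_diagonal, Matrix.diagonal_mul, blockAssemblage, Matrix.add_apply]
  simp only [pauliEffect_apply]
  fin_cases x <;> fin_cases a <;> fin_cases i <;> fin_cases j <;> simp [pauliVector, upperProj]

/-- The operators `2/7 · pauliEffect` with `η = 𝟙/2` on the last two coordinates are feasible: for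
each strategy the slack is `1/14` times a sum of two rank-one operators. -/
theorem sdpFeasible_pauliEffect :
    SDPFeasible (fun x a => (2 / 7 : ℝ) • pauliEffect x a) ((1 / 2 : ℝ) • lowerProj) := by
  refine ⟨fun x a => (pauliEffect_posSemidef x a).smul (by norm_num), ?_, fun s => ?_⟩
  · rw [trace_real_smul, trace_lowerProj]
    norm_num
  · have hcert : ∀ a b : Fin 2, ∃ v w : Fin 4 → ℂ,
        (1 / 2 : ℝ) • lowerProj - ((2 / 7 : ℝ) • pauliEffect 0 a + (2 / 7 : ℝ) • pauliEffect 1 b) =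
          (1 / 14 : ℝ) • (Matrix.vecMulVec v (star v) + Matrix.vecMulVec w (star w)) := by
      intro a b
      refine ⟨![![![0, 0, 1, -2], ![0, 0, 1, 2]], ![![0, 0, -2, 1], ![0, 0, 2, 1]]] a b,
        ![![0, 0, 0, 1], ![0, 0, 1, 0]] a, ?_⟩
      ext i j
      simp only [Matrix.sub_apply, Matrix.smul_apply, Matrix.add_apply, pauliEffect_apply,
        Matrix.vecMulVec_apply, Pi.star_apply, Complex.real_smul]
      fin_cases a <;> fin_cases b <;> fin_cases i <;> fin_cases j <;>
        norm_num [pauliVector, lowerProj]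
    obtain ⟨v, w, hvw⟩ := hcert (s 0) (s 1)
    rw [Fin.sum_univ_two, hvw]
    exact ((Matrix.posSemidef_vecMulVec_self_star v).add
      (Matrix.posSemidef_vecMulVec_self_star w)).smul (by norm_num)

theorem sdpValue_pauliEffect :
    sdpValue (fun x a => (blockAssemblage x a)ᵀ) (fun x a => (2 / 7 : ℝ) • pauliEffect x a)
      = 8 / 7 := by
  have h : ∀ x a : Fin 2, (pauliEffect x a * (blockAssemblage x a)ᵀ).trace = 1 := by
    intro x a
    simp only [Matrix.trace, Matrix.diag_apply, Matrix.mul_apply, Matrix.transpose_apply,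
      blockAssemblage, Matrix.add_apply, pauliEffect_apply, Fin.sum_univ_four]
    fin_cases x <;> fin_cases a <;> simp [pauliVector, upperProj] <;> norm_num
  rw [sdpValue_smul, sdpValue_eq_sum]
  simp only [h, Fin.sum_univ_two, Complex.one_re]
  norm_num

theorem incompatibilityRobustness_blockAssemblage_pos :
    0 < incompatibilityRobustness blockAssemblage := by
  have h := sdpValue_le_of_mem_incompatibilitySet isMeasurementAssemblage_blockAssemblage
    sdpFeasible_pauliEffect
    (isLeast_incompatibilitySet isMeasurementAssemblage_blockAssemblage).1
  rw [sdpValue_pauliEffect] at h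
  linarith

theorem IsMaximallyEntangled.isState {n : Type*} [Fintype n] [DecidableEq n] [Nonempty n]
    {ρ : Matrix (n × n) (n × n) ℂ} (h : IsMaximallyEntangled ρ) : IsState ρ := by
  obtain ⟨⟨v, rfl⟩, -, hB⟩ := h
  refine ⟨Matrix.posSemidef_vecMulVec_self_star v, ?_⟩
  rw [← trace_partialTraceB, hB, Matrix.trace_smul, Matrix.trace_one, smul_eq_mul,
    inv_mul_cancel₀ (Nat.cast_ne_zero.mpr Fintype.card_ne_zero)]

/-- With a maximally entangled state only the average of the noise over `ℂ⁴` counts, and the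
first block needs none: half of the incompatibility robustness suffices. -/
theorem steeringRobustness_blockAssemblage_lt {ρ : Matrix (Fin 4 × Fin 4) (Fin 4 × Fin 4) ℂ}
    (hρ : IsMaximallyEntangled ρ) : steeringRobustness (steeredAssemblage blockAssemblage ρ) <
      incompatibilityRobustness blockAssemblage := by
  have hA := isMeasurementAssemblage_blockAssemblage
  have hst := hρ.isState
  have hpos := incompatibilityRobustness_blockAssemblage_pos
  obtain ⟨G, hG, hG1, hGA⟩ := (mem_incompatibilitySet_iff hA).mp (isLeast_incompatibilitySet hA).1
  generalize incompatibilityRobustness blockAssemblage = t at hpos hG1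
  let H : (Fin 2 → Fin 2) → Matrix (Fin 4) (Fin 4) ℂ := fun s =>
    lowerProj * G s * lowerProj + if s = 0 then upperProj else 0
  have hcompress : ∀ M : Matrix (Fin 4) (Fin 4) ℂ, 0 ≤ M → 0 ≤ lowerProj * M * lowerProj := by
    intro M hM
    have h := ((Matrix.nonneg_iff_posSemidef.mp hM).mul_mul_conjTranspose_same lowerProj).nonneg
    rwa [lowerProj_conjTranspose] at h
  have hH : ∀ s, 0 ≤ H s := by
    intro s
    refine add_nonneg (hcompress _ (hG s)) ?_
    split_ifs
    · exact upperProj_nonneg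
    · exact le_rfl
  have hHA : ∀ x a, blockAssemblage x a ≤ coarseGraining H x a := by
    intro x a
    have h1 : coarseGraining H x a = lowerProj * coarseGraining G x a * lowerProj +
        if a = 0 then upperProj else 0 := by
      simp only [coarseGraining, H, Finset.sum_add_distrib, Finset.mul_sum, Finset.sum_mul]
      congr 1
      rw [Finset.sum_ite_eq']
      simp [eq_comm]
    have h2 := hcompress _ (sub_nonneg.mpr (hGA x a))
    rw [Matrix.mul_sub, Matrix.sub_mul, lowerProj_mul_blockAssemblage_mul, sub_nonneg] at h2
    rw [h1]
    exact add_le_add_left h2 _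
  have htr : (∑ s, H s).trace = 4 + 2 * t := by
    simp only [H, Finset.sum_add_distrib, ← Finset.mul_sum, ← Finset.sum_mul, hG1,
      Finset.sum_ite_eq', Finset.mem_univ, if_true, Matrix.mul_smul, Matrix.smul_mul, mul_one,
      lowerProj_mul_self, Matrix.trace_add, trace_real_smul, trace_lowerProj, trace_upperProj]
    push_cast
    ring
  have hmem : t / 2 ∈ steeringSet (steeredAssemblage blockAssemblage ρ) := by
    refine (mem_steeringSet_iff (isStateAssemblage_steeredAssemblage hA hst)).mpr
      ⟨fun s => steeringMap ρ (H s), fun s => steeringMap_nonneg hst.1.nonneg (hH s), ?_,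
        fun x a => ?_⟩
    · rw [← map_sum, trace_steeringMap, hρ.2.2, Matrix.mul_smul, mul_one, Matrix.trace_smul, htr,
        Fintype.card_fin, smul_eq_mul]
      have h4 : ((4 : ℕ) : ℂ)⁻¹ * (4 + 2 * t) = ((1 + t / 2 : ℝ) : ℂ) := by
        push_cast
        ring
      rw [h4, Complex.ofReal_re]
    · rw [← steeringMap_coarseGraining]
      exact steeringMap_mono hst.1.nonneg (hHA x a)
  have := (isLeast_steeringSet_steeredAssemblage hA hst).2 hmem
  linarith

theorem theorem3 :
    (∀ {n X O : Type*} [Fintype n] [DecidableEq n] [Nonempty n] [Fintype X] [Nonempty X]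
        [Fintype O] (A : X → O → Matrix n n ℂ), IsMeasurementAssemblage A →
      -- the minimum defining `IR(A)` is attained
      IsLeast (incompatibilitySet A) (incompatibilityRobustness A) ∧
      -- for every `ε > 0` there is a state of the stated form with `SR ≥ IR(A) - ε`
      (∀ ε : ℝ, 0 < ε → ∃ η : Matrix n n ℂ, η.PosDef ∧ η.trace = 1 ∧
        IsState (optimalState η) ∧
        incompatibilityRobustness A - ε ≤
          steeringRobustness (steeredAssemblage A (optimalState η))) ∧
      -- it is computed by a semidefinite program: the program (for the transposed assemblage)
      -- has an optimal solution, its optimal value is `1 + IR(A)`,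
      IsGreatest {v : ℝ | ∃ (ω : X → O → Matrix n n ℂ) (η : Matrix n n ℂ), SDPFeasible ω η ∧
          v = sdpValue (fun x a => (A x a)ᵀ) ω} (1 + incompatibilityRobustness A) ∧
      -- and every solution that is optimal up to `ε / 2` yields such a state explicitly
      (∀ ε : ℝ, 0 < ε → ∀ (ω : X → O → Matrix n n ℂ) (η : Matrix n n ℂ), SDPFeasible ω η →
        1 + incompatibilityRobustness A - ε / 2 ≤ sdpValue (fun x a => (A x a)ᵀ) ω →
        ∀ δ : ℝ, 0 < δ → δ ≤ 1 → δ * Fintype.card X ≤ ε / 2 →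
          (fullRankPerturbation δ η).PosDef ∧ (fullRankPerturbation δ η).trace = 1 ∧
          IsState (optimalState (fullRankPerturbation δ η)) ∧
          incompatibilityRobustness A - ε ≤ steeringRobustness
            (steeredAssemblage A (optimalState (fullRankPerturbation δ η)))) ∧
      -- the bound `SR ≤ IR(A)` holds for every bipartite state,
      (∀ {m : Type*} [Fintype m] [DecidableEq m] (ρ : Matrix (n × m) (n × m) ℂ), IsState ρ →
        IsLeast (steeringSet (steeredAssemblage A ρ))
          (steeringRobustness (steeredAssemblage A ρ)) ∧
        steeringRobustness (steeredAssemblage A ρ) ≤ incompatibilityRobustness A) ∧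
      -- and it is saturated
      (∃ η : Matrix n n ℂ, η.PosSemidef ∧ η.trace = 1 ∧ IsState (optimalState η) ∧
        steeringRobustness (steeredAssemblage A (optimalState η)) =
          incompatibilityRobustness A)) ∧
    -- an optimal state need not be maximally entangled
    (∃ A : Fin 2 → Fin 2 → Matrix (Fin 4) (Fin 4) ℂ, IsMeasurementAssemblage A ∧
      ∀ ρ : Matrix (Fin 4 × Fin 4) (Fin 4 × Fin 4) ℂ, IsMaximallyEntangled ρ →
        steeringRobustness (steeredAssemblage A ρ) < incompatibilityRobustness A) := by
  refine ⟨@fun n X O _ _ _ _ _ _ A hA => ?_, blockAssemblage, isMeasurementAssemblage_blockAssemblage,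
    fun ρ hρ => steeringRobustness_blockAssemblage_lt hρ⟩
  obtain ⟨ω, η, hfeas, hval⟩ := exists_sdpFeasible_eq hA
  have := hA.nonempty_outcomes
  refine ⟨isLeast_incompatibilitySet hA, fun ε hε => ?_, ⟨⟨ω, η, hfeas, hval.symm⟩, ?_⟩,
    fun ε _ ω' η' h' hv δ hδ hδ1 hδε => fullRankPerturbation_spec hA h' hv hδ hδ1 hδε,
    fun ρ hρ => ⟨isLeast_steeringSet_steeredAssemblage hA hρ, steeringRobustness_le hA hρ⟩,
    η, Matrix.nonneg_iff_posSemidef.mp hfeas.nonneg, hfeas.2.1, hfeas.isState_optimalState hA,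
    (steeringRobustness_le hA (hfeas.isState_optimalState hA)).antisymm ?_⟩
  · have hX : (0 : ℝ) < Fintype.card X := Nat.cast_pos.mpr Fintype.card_pos
    exact ⟨_, fullRankPerturbation_spec hA hfeas (δ := min 1 (ε / 2 / Fintype.card X))
      (by linarith) (lt_min one_pos (by positivity)) (min_le_left _ _)
      ((le_div_iff₀ hX).mp (min_le_right _ _))⟩
  · rintro v ⟨ω', η', h', rfl⟩
    exact sdpValue_le_of_mem_incompatibilitySet hA h' (isLeast_incompatibilitySet hA).1
  · linarith [sdpValue_le_steeringRobustness hA hfeas]
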